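/- Let $d\ge 2$ and let $\mathbb{E}^d$ be the set of nearest-neighbour edges of $\mathbb{Z}^d$ (pairs $\{v,w\}$ with $|v-w|_1=1$). Let $\tau=(\tau_e)_{e\in\mathbb{E}^d}$ be independent, identically distributed, non-negative random variables. For a finite nearest-neighbour path $\gamma$ put $\mathrm{T}(\gamma)=\sum_{e\in\gamma}\tau_e$, and for $x,y\in\mathbb{R}^d$ let $\mathrm{T}(x,y)=\inf_\gamma \mathrm{T}(\gamma)$, the infimum being over all finite paths $\gamma$ from $\lfloor x\rfloor$ to $\lfloor y\rfloor$, where $\lfloor\cdot\rfloor$ is the coordinatewise integer part. Let $\mathrm{p}_c(d)$ be the critical probability of Bernoulli bond percolation on $\mathbb{Z}^d$, i.e. the supremum of all $p\in[0,1]$ for which the open cluster of the origin is almost surely finite. A measurable function $f:(0,\infty)\to(0,\infty)$ is called slowly varying if $\lim_{t\to\infty} f(at)/f(t)=1$ for every $a>0$. Suppose that $0<r<1$ and that there are slowly varying functions $c_1,c_2,b_1,b_2$ with $\lim_{t\to\infty} b_1(t)/b_2(t)=1$ such that $$\mathbb{P}(\tau_e=0)<\mathrm{p}_c(d)\quad\text{and}\quad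 c_1(t)\,e^{-b_1(t)t^r}\le \mathbb{P}(\tau_e>t)\le c_2(t)\,e^{-b_2(t)t^r}\quad\text{for all } t>0 .$$ Then for every $x\in\mathbb{R}^d\setminus\{0\}$ the time constant $\mu(x)=\lim_{t\to\infty}t^{-1}\,\mathbb{E}[\mathrm{T}(0,tx)]$ exists in $[0,\infty)$, and for every $\xi>0$ $$\lim_{n\to\infty}\frac{1}{b_1(n)\,n^r}\log \mathbb{P}\bigl(\mathrm{T}(0,nx)>n(\mu(x)+\xi)\bigr)=-2d\,\xi^r .$$ -/

import Mathlib

open MeasureTheory ProbabilityTheory Filter Topology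
open scoped NNReal unitInterval

namespace FPP

/-- The nearest-neighbour lattice on `ℤ^d`: `v ~ w` if and only if `|v - w|₁ = 1`. -/
def lattice (d : ℕ) : SimpleGraph (Fin d → ℤ) where
  Adj v w := ∑ i, |v i - w i| = 1
  symm := ⟨fun v w h => by simpa only [abs_sub_comm] using h⟩
  loopless := ⟨fun v h => by simp at h⟩

/-- The set of (undirected) edges of the nearest-neighbour lattice on `ℤ^d`. -/
abbrev Edge (d : ℕ) : Type := (lattice d).edgeSet

section Percolation

/-- The subgraph of open edges of a bond configuration `η`. -/
def openGraph {d : ℕ} (η : Edge d → Prop) : SimpleGraph (Fin d → ℤ) where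
  Adj v w := ∃ h : (lattice d).Adj v w, η ⟨s(v, w), h⟩
  symm := ⟨by
    rintro v w ⟨h, hη⟩
    refine ⟨h.symm, ?_⟩
    have e : (⟨s(w, v), h.symm⟩ : Edge d) = ⟨s(v, w), h⟩ := Subtype.ext Sym2.eq_swap
    rw [e]
    exact hη⟩
  loopless := ⟨fun v ⟨h, _⟩ => (lattice d).loopless.irrefl v h⟩

/-- The law of Bernoulli bond percolation: every edge is open with probability `p`,
independently of all others. -/
noncomputable def bondPercolation (d : ℕ) (p : I) : Measure (Edge d → Prop) :=
  Measure.infinitePi fun _ : Edge d => bernoulliMeasure True False p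

/-- The probability that the open cluster of the origin is infinite. -/
noncomputable def percolationProb (d : ℕ) (p : I) : ℝ :=
  (bondPercolation d p).real {η | {v | (openGraph η).Reachable 0 v}.Infinite}

/-- The critical probability of Bernoulli bond percolation on `ℤ^d`. -/
noncomputable def criticalProb (d : ℕ) : ℝ :=
  sSup {q : ℝ | ∃ p : I, (p : ℝ) = q ∧ percolationProb d p = 0}

end Percolation

section PassageTime

variable {d : ℕ}

/-- The passage time of a lattice path under the edge weights `w`. -/
def pathTime (w : Edge d → ℝ≥0) : {u v : Fin d → ℤ} → (lattice d).Walk u v → ℝ≥0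
  | _, _, .nil => 0
  | u, _, .cons (v := v) h p => w ⟨s(u, v), h⟩ + pathTime w p

/-- The coordinatewise integer part of a point of `ℝ^d`. -/
noncomputable def floorPt (x : Fin d → ℝ) : Fin d → ℤ := fun i => ⌊x i⌋

/-- The first passage time between `⌊x⌋` and `⌊y⌋` under the edge weights `w`. -/
noncomputable def passageTime (w : Edge d → ℝ≥0) (x y : Fin d → ℝ) : ℝ≥0 :=
  ⨅ γ : (lattice d).Walk (floorPt x) (floorPt y), pathTime w γ

variable {Ω : Type*} [MeasurableSpace Ω]

/-- The expected first passage time `𝔼 T(0, x)`. -/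
noncomputable def meanPassageTime (P : Measure Ω) (τ : Edge d → Ω → ℝ≥0) (x : Fin d → ℝ) : ℝ :=
  ∫ ω, (passageTime (fun e => τ e ω) 0 x : ℝ) ∂P

/-- The time constant `μ(x) = lim_{t → ∞} t⁻¹ 𝔼 T(0, t x)`. -/
noncomputable def timeConstant (P : Measure Ω) (τ : Edge d → Ω → ℝ≥0) (x : Fin d → ℝ) : ℝ :=
  limUnder atTop fun t : ℝ => t⁻¹ * meanPassageTime P τ (t • x)

end PassageTime

/-- Slowly varying functions on `(0, ∞)` (values at `t ≤ 0` play no role). -/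
structure SlowlyVarying (f : ℝ → ℝ) : Prop where
  measurable : Measurable fun t : Set.Ioi (0 : ℝ) => f t
  pos : ∀ a : ℝ, 0 < a → 0 < f a
  tendsto : ∀ a : ℝ, 0 < a → Tendsto (fun t : ℝ => f (a * t) / f t) atTop (𝓝 1)

end FPP

set_option linter.unusedSectionVars false

/-! Put h(t) = -log ℙ(τ > t). Slowly varying prefactors are negligible on the exponential scale, so
h(t) ~ b₁(t) t^r, and the estimates use the common law of the weights only through h being monotone
and regularly varying with index r < 1 (`RegularTail`, `regularTail_neg_log`). It remains to see
that the late arrival has probability exp(-(2d ξ^r + o(1)) h(n)): the cheapest strategy is to make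
each of the 2d edges at one endpoint weigh about ξn.

Lower bound (`eventually_exp_le_prob`). Every path leaving 0 crosses an edge at the origin. Those 2d
edges all exceed (ξ + 2ε)n with probability exp(-2d h((ξ + 2ε)n)). Independently, the passage time
with these edges made free is at least n(μ - ε) with probability bounded below, by a second moment
argument (`exists_prob_killOrigin_ge`).

Upper bound (`eventually_prob_le_exp`). With y = ⌊nx⌋ and u = kM eⱼ one has T(0,y) ≤ T(0,u) +
T(u,y+u) + T(y+u,y). As k runs over linearly many values, the middle terms are controlled by
independent variables, each of which is at most n(μ + ε) with probability bounded below. All of them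
fail with probability exponentially small in n (`exists_prob_tubes_le`), which is negligible since
h(n) = o(n). Otherwise, for some k, the two outer terms add up to (ξ - ε)n.

Each outer term is bounded by every one of 2d edge-disjoint connections (`petal`), whose length is a
small multiple of n. A sum of so few heavy-tailed weights is large only through one big jump, so it
exceeds αn at cost about α^r h(n) (`exists_sum_tail_le`). If the minima over the petals at the two
ends are αn and βn, the cost is 2d(α^r + β^r) h(n) ≥ 2d(α + β)^r h(n), because r < 1
(`eventually_prob_two_minima_le`). Thus it is optimal to block one endpoint only. -/

namespace FPP

/-! ### Lattice edges and finite connections. -/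

section Lattice

variable {d : ℕ}

lemma lattice_adj_add_single (p : Fin d → ℤ) (i : Fin d) :
    (lattice d).Adj p (p + Pi.single i 1) := by
  change ∑ k, |p k - (p + Pi.single i 1 : Fin d → ℤ) k| = 1
  simp [Pi.single_apply, apply_ite abs]

/-- The edge from `p` to `p + eᵢ`. -/
def latEdge (p : Fin d → ℤ) (i : Fin d) : Edge d :=
  ⟨s(p, p + Pi.single i 1), lattice_adj_add_single p i⟩

lemma latEdge_inj {p q : Fin d → ℤ} {i k : Fin d} :
    latEdge p i = latEdge q k ↔ p = q ∧ i = k := by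
  constructor
  · intro h
    have h' : s(p, p + Pi.single i (1 : ℤ)) = s(q, q + Pi.single k 1) := congrArg Subtype.val h
    rcases Sym2.eq_iff.1 h' with ⟨h1, h2⟩ | ⟨h1, h2⟩
    · refine ⟨h1, ?_⟩
      subst h1
      have h3 := congrFun (add_left_cancel h2) i
      by_contra hik
      simp [hik] at h3
    · exfalso
      have h3 := congrFun h1 i
      have h4 := congrFun h2 i
      simp only [Pi.add_apply, Pi.single_eq_same] at h3 h4
      have h5 : (0 : ℤ) ≤ (Pi.single k (1 : ℤ) : Fin d → ℤ) i := by
        rw [Pi.single_apply]; split_ifs <;> norm_num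
      omega
  · rintro ⟨rfl, rfl⟩; rfl

lemma lattice_adj_cases {u v : Fin d → ℤ} (h : (lattice d).Adj u v) :
    ∃ i, v = u + Pi.single i 1 ∨ u = v + Pi.single i 1 := by
  have h1 : ∑ k, |u k - v k| = 1 := h
  have h2 : ∃ i, u i - v i ≠ 0 := by
    by_contra hc
    push Not at hc
    simp [hc] at h1
  obtain ⟨i, hi⟩ := h2
  have h3 : |u i - v i| + ∑ k ∈ Finset.univ.erase i, |u k - v k| = 1 := by
    rw [← h1]
    exact Finset.add_sum_erase _ (fun k => |u k - v k|) (Finset.mem_univ i)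
  have h4 : 0 ≤ ∑ k ∈ Finset.univ.erase i, |u k - v k| :=
    Finset.sum_nonneg fun _ _ => abs_nonneg _
  have h5 : 1 ≤ |u i - v i| := Int.one_le_abs hi
  have h6 : ∑ k ∈ Finset.univ.erase i, |u k - v k| = 0 := by omega
  have h7 : ∀ k, k ≠ i → u k = v k := fun k hk => by
    have := (Finset.sum_eq_zero_iff_of_nonneg fun _ _ => abs_nonneg _).1 h6 k
      (Finset.mem_erase.2 ⟨hk, Finset.mem_univ _⟩)
    have := abs_eq_zero.1 this
    omega
  have h8 : |u i - v i| = 1 := by omega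
  refine ⟨i, ?_⟩
  rcases (abs_eq (by norm_num : (0 : ℤ) ≤ 1)).1 h8 with h9 | h9
  · right
    ext k
    by_cases hk : k = i
    · subst hk; simp; omega
    · simp [hk, h7 k hk]
  · left
    ext k
    by_cases hk : k = i
    · subst hk; simp; omega
    · simp [hk, h7 k hk]

/-- The set of edges `{p + t eᵢ, p + (t + 1) eᵢ}` with `t < R`. -/
noncomputable def lineEdges (p : Fin d → ℤ) (i : Fin d) (R : ℕ) : Finset (Edge d) :=
  open Classical in
  (Finset.range R).image fun t : ℕ => latEdge (p + Pi.single i (t : ℤ)) i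

lemma mem_lineEdges {p : Fin d → ℤ} {i : Fin d} {R : ℕ} {e : Edge d} :
    e ∈ lineEdges p i R ↔ ∃ t < R, latEdge (p + Pi.single i (t : ℤ)) i = e := by
  classical
  simp [lineEdges]

lemma card_lineEdges_le (p : Fin d → ℤ) (i : Fin d) (R : ℕ) : (lineEdges p i R).card ≤ R := by
  classical
  unfold lineEdges
  exact Finset.card_image_le.trans (by simp)

/-- `u` and `v` are connected by a path which uses only edges of `E`. -/
def ConnectedIn (E : Finset (Edge d)) (u v : Fin d → ℤ) : Prop :=
  (openGraph fun e : Edge d => e ∈ E).Reachable u v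

namespace ConnectedIn

variable {E E' : Finset (Edge d)} {u v w : Fin d → ℤ}

lemma refl : ConnectedIn E u u := SimpleGraph.Reachable.refl u

lemma symm (h : ConnectedIn E u v) : ConnectedIn E v u := SimpleGraph.Reachable.symm h

lemma trans (h : ConnectedIn E u v) (h' : ConnectedIn E v w) : ConnectedIn E u w :=
  SimpleGraph.Reachable.trans h h'

lemma mono (hE : E ⊆ E') (h : ConnectedIn E u v) : ConnectedIn E' u v := by
  have hle : (openGraph fun e : Edge d => e ∈ E) ≤ openGraph fun e : Edge d => e ∈ E' :=
    fun _ _ ⟨ha, hη⟩ => ⟨ha, hE hη⟩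
  exact SimpleGraph.Reachable.mono hle h

lemma of_latEdge {p : Fin d → ℤ} {i : Fin d} (h : latEdge p i ∈ E) :
    ConnectedIn E p (p + Pi.single i 1) := by
  apply SimpleGraph.Adj.reachable
  exact ⟨lattice_adj_add_single p i, h⟩

lemma of_lineEdges (p : Fin d → ℤ) (i : Fin d) (R : ℕ) :
    ConnectedIn (lineEdges p i R) p (p + Pi.single i (R : ℤ)) := by
  induction R with
  | zero => simpa using refl
  | succ R ih =>
    refine (ih.mono fun e he => ?_).trans ?_ (v := p + Pi.single i (R : ℤ))
    · obtain ⟨t, ht, rfl⟩ := mem_lineEdges.1 he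
      exact mem_lineEdges.2 ⟨t, by omega, rfl⟩
    · have h : latEdge (p + Pi.single i (R : ℤ)) i ∈ lineEdges p i (R + 1) :=
        mem_lineEdges.2 ⟨R, by omega, rfl⟩
      have := of_latEdge h
      rwa [add_assoc, ← Pi.single_add] at this

end ConnectedIn

/-- Any two lattice points are connected by at most `|u - v|₁` edges. -/
lemma exists_connectedIn (u v : Fin d → ℤ) :
    ∃ E : Finset (Edge d), (E.card : ℤ) ≤ ∑ i, |u i - v i| ∧ ConnectedIn E u v := by
  classical
  suffices H : ∀ n : ℕ, ∀ u v : Fin d → ℤ, ∑ i, |u i - v i| = (n : ℤ) →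
      ∃ E : Finset (Edge d), E.card ≤ n ∧ ConnectedIn E u v by
    have h0 : 0 ≤ ∑ i, |u i - v i| := Finset.sum_nonneg fun _ _ => abs_nonneg _
    obtain ⟨E, h1, h2⟩ := H (∑ i, |u i - v i|).toNat u v (by omega)
    exact ⟨E, by omega, h2⟩
  intro n
  induction n with
  | zero =>
    intro u v h
    refine ⟨∅, by simp, ?_⟩
    have : u = v := by
      ext i
      have := (Finset.sum_eq_zero_iff_of_nonneg fun _ _ => abs_nonneg _).1 h i (Finset.mem_univ i)
      have := abs_eq_zero.1 this
      omega
    rw [this]; exact ConnectedIn.refl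
  | succ n ih =>
    suffices step : ∀ u v : Fin d → ℤ, ∀ i, u i < v i → ∑ i, |u i - v i| = ((n + 1 : ℕ) : ℤ) →
        ∃ E : Finset (Edge d), E.card ≤ n + 1 ∧ ConnectedIn E u v by
      intro u v h
      have h2 : ∃ i, u i ≠ v i := by
        by_contra hc
        push Not at hc
        simp [hc] at h
        omega
      obtain ⟨i, hi⟩ := h2
      rcases lt_or_gt_of_ne hi with hi | hi
      · exact step u v i hi h
      · obtain ⟨E, h3, h4⟩ := step v u i hi (by rw [← h]; simp only [abs_sub_comm])
        exact ⟨E, h3, h4.symm⟩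
    intro u v i hi h
    obtain ⟨E, hE, hc⟩ := ih (u + Pi.single i 1) v (by
      rw [← Finset.add_sum_erase _ _ (Finset.mem_univ i)] at h ⊢
      have e1 : ∑ k ∈ Finset.univ.erase i, |(u + Pi.single i 1 : Fin d → ℤ) k - v k| =
          ∑ k ∈ Finset.univ.erase i, |u k - v k| := by
        refine Finset.sum_congr rfl fun k hk => ?_
        simp [Finset.ne_of_mem_erase hk]
      rw [e1]
      have e2 : |(u + Pi.single i 1 : Fin d → ℤ) i - v i| = |u i - v i| - 1 := by
        simp only [Pi.add_apply, Pi.single_eq_same]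
        rw [abs_of_nonpos (by omega), abs_of_nonpos (by omega)]
        ring
      push_cast at h
      omega)
    refine ⟨insert (latEdge u i) E, (Finset.card_insert_le _ _).trans (by omega), ?_⟩
    exact (ConnectedIn.of_latEdge (Finset.mem_insert_self _ _)).trans
      (hc.mono (Finset.subset_insert _ _))

lemma lattice_reachable (u v : Fin d → ℤ) : (lattice d).Reachable u v := by
  obtain ⟨E, -, h⟩ := exists_connectedIn u v
  have hle : (openGraph fun e : Edge d => e ∈ E) ≤ lattice d := fun _ _ ⟨h, _⟩ => h
  exact SimpleGraph.Reachable.mono hle h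

instance (u v : Fin d → ℤ) : Nonempty ((lattice d).Walk u v) := lattice_reachable u v

instance (u v : Fin d → ℤ) : Countable ((lattice d).Walk u v) :=
  Function.Injective.countable (f := fun p : (lattice d).Walk u v => p.support)
    fun _ _ h => SimpleGraph.Walk.ext_support h

end Lattice

/-! ### Passage times between lattice points. -/

section PathTime

variable {d : ℕ}

/-- The weights `w`, extended by zero to all unordered pairs. -/
noncomputable def extWeight (w : Edge d → ℝ≥0) (e : Sym2 (Fin d → ℤ)) : ℝ≥0 :=
  open Classical in if h : e ∈ (lattice d).edgeSet then w ⟨e, h⟩ else 0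

lemma extWeight_coe (w : Edge d → ℝ≥0) (e : Edge d) : extWeight w e = w e := by
  simp [extWeight]

lemma pathTime_eq_sum (w : Edge d → ℝ≥0) {u v : Fin d → ℤ} (γ : (lattice d).Walk u v) :
    pathTime w γ = (γ.edges.map (extWeight w)).sum := by
  induction γ with
  | nil => simp [pathTime]
  | cons h p ih =>
    have := extWeight_coe w ⟨s(_, _), h⟩
    simp only at this
    simp [pathTime, ih, this]

lemma pathTime_append (w : Edge d → ℝ≥0) {u v x : Fin d → ℤ} (γ : (lattice d).Walk u v)
    (γ' : (lattice d).Walk v x) : pathTime w (γ.append γ') = pathTime w γ + pathTime w γ' := by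
  simp [pathTime_eq_sum]

lemma pathTime_reverse (w : Edge d → ℝ≥0) {u v : Fin d → ℤ} (γ : (lattice d).Walk u v) :
    pathTime w γ.reverse = pathTime w γ := by
  simp [pathTime_eq_sum, List.sum_reverse]

lemma pathTime_mono {w w' : Edge d → ℝ≥0} (h : w ≤ w') {u v : Fin d → ℤ}
    (γ : (lattice d).Walk u v) : pathTime w γ ≤ pathTime w' γ := by
  induction γ with
  | nil => exact le_rfl
  | cons _ _ ih => exact add_le_add (h _) ih

lemma pathTime_add (w w' : Edge d → ℝ≥0) {u v : Fin d → ℤ} (γ : (lattice d).Walk u v) :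
    pathTime (w + w') γ = pathTime w γ + pathTime w' γ := by
  induction γ with
  | nil => simp [pathTime]
  | cons _ _ ih => simp only [pathTime, ih, Pi.add_apply]; ring

lemma measurable_pathTime {u v : Fin d → ℤ} (γ : (lattice d).Walk u v) :
    Measurable fun w : Edge d → ℝ≥0 => pathTime w γ := by
  induction γ with
  | nil => exact measurable_const
  | cons _ _ ih => exact (measurable_pi_apply _).add ih

/-- A walk without repeated edges pays each weight at most once. Edges of zero weight need not lie
in `E`, so that the bound also applies to weights supported on a small set. -/
lemma pathTime_le_sum_of_nodup (w : Edge d → ℝ≥0) {u v : Fin d → ℤ} (γ : (lattice d).Walk u v)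
    (hγ : γ.edges.Nodup) (E : Finset (Edge d))
    (hE : ∀ e : Edge d, (e : Sym2 (Fin d → ℤ)) ∈ γ.edges → w e ≠ 0 → e ∈ E) :
    pathTime w γ ≤ ∑ e ∈ E, w e := by
  classical
  rw [pathTime_eq_sum, ← List.sum_toFinset _ hγ]
  have h1 : ∑ e ∈ E, w e = ∑ e ∈ E.image Subtype.val, extWeight w e := by
    rw [Finset.sum_image fun _ _ _ _ h => Subtype.ext h]
    simp [extWeight_coe]
  rw [h1]
  refine Finset.sum_le_sum_of_ne_zero fun e he hne => ?_
  rw [List.mem_toFinset] at he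
  have hs := γ.edges_subset_edgeSet he
  refine Finset.mem_image.2 ⟨⟨e, hs⟩, hE ⟨e, hs⟩ he ?_, rfl⟩
  rw [← extWeight_coe w ⟨e, hs⟩]
  exact hne

/-- The first passage time between two lattice points. -/
noncomputable def latticeTime (w : Edge d → ℝ≥0) (u v : Fin d → ℤ) : ℝ≥0 :=
  ⨅ γ : (lattice d).Walk u v, pathTime w γ

lemma passageTime_eq (w : Edge d → ℝ≥0) (x y : Fin d → ℝ) :
    passageTime w x y = latticeTime w (floorPt x) (floorPt y) := rfl

lemma latticeTime_le_pathTime (w : Edge d → ℝ≥0) {u v : Fin d → ℤ} (γ : (lattice d).Walk u v) :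
    latticeTime w u v ≤ pathTime w γ := ciInf_le (OrderBot.bddBelow _) γ

lemma le_latticeTime {w : Edge d → ℝ≥0} {u v : Fin d → ℤ} {a : ℝ≥0}
    (h : ∀ γ : (lattice d).Walk u v, a ≤ pathTime w γ) : a ≤ latticeTime w u v := le_ciInf h

lemma latticeTime_triangle (w : Edge d → ℝ≥0) (u v x : Fin d → ℤ) :
    latticeTime w u x ≤ latticeTime w u v + latticeTime w v x := by
  refine NNReal.le_iInf_add_iInf fun γ γ' => ?_
  rw [← pathTime_append]
  exact latticeTime_le_pathTime _ _

lemma latticeTime_comm (w : Edge d → ℝ≥0) (u v : Fin d → ℤ) :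
    latticeTime w u v = latticeTime w v u := by
  have h : ∀ u v, latticeTime w u v ≤ latticeTime w v u := fun u v =>
    le_latticeTime fun γ => by
      rw [← pathTime_reverse]
      exact latticeTime_le_pathTime _ _
  exact le_antisymm (h _ _) (h _ _)

lemma latticeTime_self (w : Edge d → ℝ≥0) (u : Fin d → ℤ) : latticeTime w u u = 0 :=
  le_antisymm (latticeTime_le_pathTime w SimpleGraph.Walk.nil) zero_le

lemma measurable_latticeTime (u v : Fin d → ℤ) :
    Measurable fun w : Edge d → ℝ≥0 => latticeTime w u v :=
  Measurable.iInf fun γ => measurable_pathTime γ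

/-- Loop erasure turns the connection into a path inside `E` that uses each edge at most once. This
is how explicit edge sets give upper bounds on passage times. -/
lemma ConnectedIn.latticeTime_le {E : Finset (Edge d)} {u v : Fin d → ℤ} (h : ConnectedIn E u v)
    (w : Edge d → ℝ≥0) : latticeTime w u v ≤ ∑ e ∈ E, w e := by
  classical
  obtain ⟨p⟩ := h
  have hle : (openGraph fun e : Edge d => e ∈ E) ≤ lattice d := fun _ _ ⟨h, _⟩ => h
  refine (latticeTime_le_pathTime w (p.bypass.mapLe hle)).trans
    (pathTime_le_sum_of_nodup _ _ ?_ _ ?_)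
  · rw [SimpleGraph.Walk.edges_mapLe_eq_edges]
    exact p.bypass_isPath.isTrail.edges_nodup
  · rintro ⟨e, he'⟩ he -
    rw [SimpleGraph.Walk.edges_mapLe_eq_edges] at he
    have := p.bypass.edges_subset_edgeSet he
    revert he' this
    refine Sym2.ind (fun a b => ?_) e
    intro _ _ h
    exact h.2

end PathTime

/-! ### Translation covariance. -/

section Shift

variable {d : ℕ}

/-- Translation by `a`, as an automorphism of the lattice. -/
def shiftIso (a : Fin d → ℤ) : lattice d ≃g lattice d where
  toEquiv := Equiv.addRight a
  map_rel_iff' := by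
    intro u v
    change ∑ i, |(u + a) i - (v + a) i| = 1 ↔ ∑ i, |u i - v i| = 1
    simp

/-- Translation by `a` on the edges. -/
def shift (a : Fin d → ℤ) : Edge d ≃ Edge d := (shiftIso a).mapEdgeSet

lemma shift_latEdge (a p : Fin d → ℤ) (i : Fin d) : shift a (latEdge p i) = latEdge (p + a) i := by
  apply Subtype.ext
  change s(p + a, p + Pi.single i 1 + a) = s(p + a, p + a + Pi.single i 1)
  rw [add_right_comm]

lemma shift_shift (a b : Fin d → ℤ) (e : Edge d) : shift a (shift b e) = shift (b + a) e := by
  obtain ⟨e, he⟩ := e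
  revert he
  refine Sym2.ind (fun u v => ?_) e
  intro h
  apply Subtype.ext
  change s(u + b + a, v + b + a) = s(u + (b + a), v + (b + a))
  simp only [add_assoc]

lemma pathTime_map_shiftIso (w : Edge d → ℝ≥0) (a : Fin d → ℤ) {u v : Fin d → ℤ}
    (γ : (lattice d).Walk u v) :
    pathTime w (γ.map (shiftIso a).toHom) = pathTime (w ∘ shift a) γ := by
  induction γ with
  | nil => rfl
  | cons h p ih =>
    simp only [SimpleGraph.Walk.map_cons, pathTime, ih]
    rfl

lemma latticeTime_shift_le (w : Edge d → ℝ≥0) (a u v : Fin d → ℤ) :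
    latticeTime w (u + a) (v + a) ≤ latticeTime (w ∘ shift a) u v :=
  le_latticeTime fun γ => by
    rw [← pathTime_map_shiftIso]
    exact latticeTime_le_pathTime w (γ.map (shiftIso a).toHom)

lemma latticeTime_shift (w : Edge d → ℝ≥0) (a u v : Fin d → ℤ) :
    latticeTime (w ∘ shift a) u v = latticeTime w (u + a) (v + a) := by
  refine le_antisymm ?_ (latticeTime_shift_le w a u v)
  have h := latticeTime_shift_le (w ∘ shift a) (-a) (u + a) (v + a)
  simp only [add_neg_cancel_right] at h
  refine h.trans (le_of_eq ?_)
  congr 1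
  ext e
  simp only [Function.comp_apply, shift_shift, neg_add_cancel]
  congr 2
  obtain ⟨e, he⟩ := e
  revert he
  refine Sym2.ind (fun u v => ?_) e
  intro h
  apply Subtype.ext
  change s(u + 0, v + 0) = s(u, v)
  simp

end Shift

/-! ### The edges at the origin. -/

section Origin

variable {d : ℕ}

/-- The `2d` edges at the origin, indexed by direction and sign. -/
def originEdge : Fin d × Bool → Edge d
  | (i, true) => latEdge 0 i
  | (i, false) => latEdge (-Pi.single i 1) i

lemma originEdge_injective : Function.Injective (originEdge : Fin d × Bool → Edge d) := by
  have h : ∀ i : Fin d, (0 : Fin d → ℤ) ≠ -Pi.single i 1 := fun i h => by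
    have := congrFun h i
    simp at this
  rintro ⟨i, _ | _⟩ ⟨k, _ | _⟩ hik <;> simp only [originEdge, latEdge_inj] at hik
  · rw [hik.2]
  · exact absurd hik.1.symm (h i)
  · exact absurd hik.1 (h k)
  · rw [hik.2]

lemma exists_originEdge {v : Fin d → ℤ} (h : (lattice d).Adj 0 v) :
    ∃ k, originEdge k = (⟨s(0, v), h⟩ : Edge d) := by
  obtain ⟨i, rfl | hi⟩ := lattice_adj_cases h
  · exact ⟨(i, true), rfl⟩
  · refine ⟨(i, false), Subtype.ext ?_⟩
    have : v = -Pi.single i 1 := by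
      rw [eq_neg_iff_add_eq_zero]; exact hi.symm
    subst this
    change s(-Pi.single i 1, -Pi.single i 1 + Pi.single i 1) = s(0, -Pi.single i 1)
    simp [Sym2.eq_swap]

/-- The weights `w`, with those of the edges in the range of `originEdge` replaced by zero. -/
noncomputable def killOrigin (w : Edge d → ℝ≥0) (e : Edge d) : ℝ≥0 :=
  open Classical in if e ∈ Set.range (originEdge : Fin d × Bool → Edge d) then 0 else w e

lemma killOrigin_le (w : Edge d → ℝ≥0) : killOrigin w ≤ w := fun e => by
  unfold killOrigin; split_ifs <;> simp

/-- After loop erasure a path crosses each of the `2d` origin edges at most once, so restoring their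
weights costs at most their sum, which does not grow with the distance. -/
lemma latticeTime_le_killOrigin_add (w : Edge d → ℝ≥0) (u v : Fin d → ℤ) :
    latticeTime w u v ≤ latticeTime (killOrigin w) u v + ∑ k, w (originEdge k) := by
  classical
  rw [← tsub_le_iff_right]
  refine le_latticeTime fun γ => ?_
  rw [tsub_le_iff_right]
  set w₁ : Edge d → ℝ≥0 := fun e => if e ∈ Set.range (originEdge : Fin d × Bool → Edge d)
    then w e else 0 with hw₁
  have hw : w = killOrigin w + w₁ := by
    ext e
    simp only [killOrigin, hw₁, Pi.add_apply]
    split_ifs <;> simp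
  calc latticeTime w u v ≤ pathTime w γ.bypass := latticeTime_le_pathTime _ _
    _ = pathTime (killOrigin w) γ.bypass + pathTime w₁ γ.bypass := by
      conv_lhs => rw [hw]
      exact pathTime_add _ _ _
    _ ≤ _ := by
      refine add_le_add ?_ ?_
      · rw [pathTime_eq_sum, pathTime_eq_sum]
        rw [← List.sum_toFinset _ γ.bypass_isPath.isTrail.edges_nodup]
        calc _ ≤ ∑ e ∈ γ.edges.toFinset, extWeight (killOrigin w) e :=
              Finset.sum_le_sum_of_subset fun e he => by
                rw [List.mem_toFinset] at he ⊢
                exact γ.edges_bypass_subset_edges he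
          _ ≤ _ := by
            rw [Finset.sum_list_map_count]
            refine Finset.sum_le_sum fun e he => ?_
            have : 1 ≤ γ.edges.count e := List.one_le_count_iff.2 (List.mem_toFinset.1 he)
            rw [nsmul_eq_mul]
            exact le_mul_of_one_le_left zero_le (by exact_mod_cast this)
      · refine (pathTime_le_sum_of_nodup _ _ γ.bypass_isPath.isTrail.edges_nodup
          (Finset.univ.image originEdge) fun e _ he => ?_).trans ?_
        · by_contra hc
          apply he
          rw [hw₁]
          simp only [Set.mem_range]
          rw [if_neg]
          simpa using hc
        · rw [Finset.sum_image fun _ _ _ _ h => originEdge_injective h]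
          refine Finset.sum_le_sum fun k _ => ?_
          simp only [hw₁]
          split_ifs <;> simp

/-- The first step of a path from `0` to `v ≠ 0` crosses an origin edge, which costs at least `a`
under `w` and nothing under `killOrigin w`. -/
lemma add_killOrigin_le_latticeTime {w : Edge d → ℝ≥0} {v : Fin d → ℤ} (hv : v ≠ 0) {a : ℝ≥0}
    (ha : ∀ k, a ≤ w (originEdge k)) :
    a + latticeTime (killOrigin w) 0 v ≤ latticeTime w 0 v := by
  refine le_latticeTime fun γ => ?_
  refine (add_le_add_right (latticeTime_le_pathTime _ γ) a).trans ?_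
  cases γ with
  | nil => exact absurd rfl hv
  | cons h p =>
    obtain ⟨k, hk⟩ := exists_originEdge h
    have h0 : killOrigin w (⟨s(0, _), h⟩ : Edge d) = 0 := by
      rw [← hk]; simp [killOrigin]
    simp only [pathTime]
    rw [h0, zero_add, ← hk]
    exact add_le_add (ha k) (pathTime_mono (killOrigin_le w) p)

end Origin

variable {d : ℕ} {Ω : Type*} [MeasurableSpace Ω]

/-- Independent, identically distributed, square integrable edge weights. -/
structure IIDWeights (P : Measure Ω) (τ : Edge d → Ω → ℝ≥0) : Prop where
  measurable : ∀ e, Measurable (τ e)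
  indep : iIndepFun τ P
  ident : ∀ e e', IdentDistrib (τ e) (τ e') P P
  memLp : ∀ e, MemLp (fun ω => (τ e ω : ℝ)) 2 P

/-- The configuration of all edge weights. -/
def config (τ : Edge d → Ω → ℝ≥0) (ω : Ω) : Edge d → ℝ≥0 := fun e => τ e ω

/-! ### Independence over disjoint edge sets and invariance in law. -/

section Independence

variable {P : Measure Ω} {τ : Edge d → Ω → ℝ≥0}

/-- The sigma-algebra generated by the weights of the edges in `S`. -/
@[reducible]
def edgeSigma (τ : Edge d → Ω → ℝ≥0) (S : Set (Edge d)) : MeasurableSpace Ω :=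
  ⨆ e ∈ S, MeasurableSpace.comap (τ e) inferInstance

lemma edgeSigma_mono (τ : Edge d → Ω → ℝ≥0) {S T : Set (Edge d)} (h : S ⊆ T) :
    edgeSigma τ S ≤ edgeSigma τ T := biSup_mono fun _ he => h he

/-- Setting all weights outside `S` to zero does not change the event, and the modified
configuration is measurable with respect to the weights in `S`. -/
lemma measurableSet_edgeSigma {S : Set (Edge d)} {B : Set (Edge d → ℝ≥0)} (hB : MeasurableSet B)
    (hS : DependsOn (fun w => w ∈ B) S) : MeasurableSet[edgeSigma τ S] {ω | config τ ω ∈ B} := by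
  classical
  have h1 : {ω | config τ ω ∈ B} =
      (fun ω => (fun e => if e ∈ S then τ e ω else 0 : Edge d → ℝ≥0)) ⁻¹' B := by
    ext ω
    have := hS (x := config τ ω) (y := fun e => if e ∈ S then τ e ω else 0) fun e he => by
      simp [config, he]
    simp only at this
    simp only [Set.mem_ofPred_eq, Set.mem_preimage, this]
  rw [h1]
  refine (@measurable_pi_lambda Ω (Edge d) (fun _ => ℝ≥0) (edgeSigma τ S) _ _ fun e => ?_) hB
  by_cases he : e ∈ S
  · simp only [he, if_true]
    exact (comap_measurable (τ e)).mono (le_biSup (fun e => MeasurableSpace.comap (τ e) _) he) le_rfl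
  · simp only [he, if_false]
    exact @measurable_const _ _ _ (edgeSigma τ S) _

lemma indep_edgeSigma (hm : ∀ e, Measurable (τ e)) (hi : iIndepFun τ P) {S T : Set (Edge d)}
    (h : Disjoint S T) : Indep (edgeSigma τ S) (edgeSigma τ T) P :=
  indep_iSup_of_disjoint (fun e => (hm e).comap_le) hi h

/-- Events that depend on pairwise disjoint sets of edges are independent. -/
lemma measureReal_iInter_config (hm : ∀ e, Measurable (τ e)) (hi : iIndepFun τ P) {ι : Type*}
    (s : Finset ι) (S : ι → Set (Edge d)) (B : ι → Set (Edge d → ℝ≥0))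
    (hB : ∀ k ∈ s, MeasurableSet (B k)) (hS : ∀ k ∈ s, DependsOn (fun w => w ∈ B k) (S k))
    (hd : (s : Set ι).Pairwise fun k l => Disjoint (S k) (S l)) :
    P.real {ω | ∀ k ∈ s, config τ ω ∈ B k} = ∏ k ∈ s, P.real {ω | config τ ω ∈ B k} := by
  classical
  have := hi.isProbabilityMeasure
  induction s using Finset.induction_on with
  | empty => simp
  | insert k s hk ih =>
    rw [Finset.prod_insert hk, ← ih (fun l hl => hB l (Finset.mem_insert_of_mem hl))
      (fun l hl => hS l (Finset.mem_insert_of_mem hl))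
      (hd.mono fun l hl => Finset.mem_insert_of_mem hl)]
    have h1 : {ω | ∀ l ∈ insert k s, config τ ω ∈ B l} =
        {ω | config τ ω ∈ B k} ∩ {ω | ∀ l ∈ s, config τ ω ∈ B l} := by
      ext ω; simp
    have hdis : Disjoint (S k) (⋃ l ∈ s, S l) := by
      rw [Set.disjoint_iUnion₂_right]
      intro l hl
      exact hd (Finset.mem_insert_self _ _) (Finset.mem_insert_of_mem hl)
        fun h => hk (h ▸ hl)
    have h2 := (Indep_iff _ _ _).1 (indep_edgeSigma hm hi hdis) {ω | config τ ω ∈ B k}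
      {ω | ∀ l ∈ s, config τ ω ∈ B l}
      (measurableSet_edgeSigma (hB k (Finset.mem_insert_self _ _))
        (hS k (Finset.mem_insert_self _ _))) (by
        have h3 : {ω | ∀ l ∈ s, config τ ω ∈ B l} = ⋂ l ∈ s, {ω | config τ ω ∈ B l} := by
          ext ω; simp
        rw [h3]
        refine Finset.measurableSet_biInter _ fun l hl => ?_
        exact edgeSigma_mono τ (Set.subset_biUnion_of_mem (u := S) hl) _
          (measurableSet_edgeSigma (hB l (Finset.mem_insert_of_mem hl))
            (hS l (Finset.mem_insert_of_mem hl))))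
    rw [h1, Measure.real, h2, ENNReal.toReal_mul]
    rfl

lemma identDistrib_config_comp (hm : ∀ e, Measurable (τ e)) (hi : iIndepFun τ P)
    (hid : ∀ e e', IdentDistrib (τ e) (τ e') P P) {f : Edge d → Edge d}
    (hf : Function.Injective f) :
    IdentDistrib (fun ω => config τ ω ∘ f) (config τ) P P := by
  have := hi.isProbabilityMeasure
  refine ⟨(measurable_pi_lambda _ fun e => hm _).aemeasurable,
    (measurable_pi_lambda _ fun e => hm _).aemeasurable, ?_⟩
  have h1 := (iIndepFun_iff_map_fun_eq_infinitePi_map hm).1 hi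
  have h2 := (iIndepFun_iff_map_fun_eq_infinitePi_map (fun e => hm (f e))).1 (hi.precomp hf)
  change P.map (fun ω e => τ (f e) ω) = P.map (fun ω e => τ e ω)
  rw [h1, h2]
  congr 1
  ext1 e
  exact (hid _ _).map_eq

end Independence

/-! ### Moments, stationarity and local approximation of passage times. -/

namespace IIDWeights

variable {P : Measure Ω} {τ : Edge d → Ω → ℝ≥0}

lemma isProbabilityMeasure (h : IIDWeights P τ) : IsProbabilityMeasure P :=
  h.indep.isProbabilityMeasure

lemma measurable_config (h : IIDWeights P τ) : Measurable (config τ) :=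
  measurable_pi_lambda _ fun e => h.measurable e

lemma integrable (h : IIDWeights P τ) (e : Edge d) : Integrable (fun ω => (τ e ω : ℝ)) P := by
  have := h.isProbabilityMeasure
  exact (h.memLp e).integrable (by norm_num)

lemma integral_comp_shift (h : IIDWeights P τ) (a : Fin d → ℤ) {g : (Edge d → ℝ≥0) → ℝ}
    (hg : Measurable g) :
    ∫ ω, g (config τ ω ∘ shift a) ∂P = ∫ ω, g (config τ ω) ∂P :=
  ((identDistrib_config_comp h.measurable h.indep h.ident (shift a).injective).comp hg).integral_eq

lemma integrable_comp_shift (h : IIDWeights P τ) (a : Fin d → ℤ) {g : (Edge d → ℝ≥0) → ℝ}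
    (hg : Measurable g) (hgi : Integrable (fun ω => g (config τ ω)) P) :
    Integrable (fun ω => g (config τ ω ∘ shift a)) P :=
  ((identDistrib_config_comp h.measurable h.indep h.ident
    (shift a).injective).comp hg).integrable_iff.2 hgi

lemma memLp_sum (h : IIDWeights P τ) (E : Finset (Edge d)) :
    MemLp (fun ω => ((∑ e ∈ E, config τ ω e : ℝ≥0) : ℝ)) 2 P := by
  simp only [NNReal.coe_sum, config]
  exact memLp_finsetSum _ fun e _ => h.memLp e

lemma measurable_latticeTime (h : IIDWeights P τ) (u v : Fin d → ℤ) :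
    Measurable fun ω => (latticeTime (config τ ω) u v : ℝ) :=
  ((FPP.measurable_latticeTime u v).comp h.measurable_config).coe_nnreal_real

lemma memLp_latticeTime (h : IIDWeights P τ) (u v : Fin d → ℤ) :
    MemLp (fun ω => (latticeTime (config τ ω) u v : ℝ)) 2 P := by
  obtain ⟨E, -, hE⟩ := exists_connectedIn u v
  refine (h.memLp_sum E).mono (h.measurable_latticeTime u v).aestronglyMeasurable
    (Eventually.of_forall fun ω => ?_)
  simp only [Real.norm_eq_abs, NNReal.abs_eq]
  exact_mod_cast hE.latticeTime_le _

lemma integrable_latticeTime (h : IIDWeights P τ) (u v : Fin d → ℤ) :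
    Integrable (fun ω => (latticeTime (config τ ω) u v : ℝ)) P := by
  have := h.isProbabilityMeasure
  exact (h.memLp_latticeTime u v).integrable (by norm_num)

end IIDWeights

/-- The mean first passage time between two lattice points. -/
noncomputable def meanTime (P : Measure Ω) (τ : Edge d → Ω → ℝ≥0) (u v : Fin d → ℤ) : ℝ :=
  ∫ ω, (latticeTime (config τ ω) u v : ℝ) ∂P

lemma meanTime_nonneg (P : Measure Ω) (τ : Edge d → Ω → ℝ≥0) (u v : Fin d → ℤ) :
    0 ≤ meanTime P τ u v := integral_nonneg fun _ => NNReal.coe_nonneg _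

namespace IIDWeights

variable {P : Measure Ω} {τ : Edge d → Ω → ℝ≥0}

lemma meanTime_add (h : IIDWeights P τ) (u v a : Fin d → ℤ) :
    meanTime P τ (u + a) (v + a) = meanTime P τ u v := by
  unfold meanTime
  simp only [← latticeTime_shift]
  exact h.integral_comp_shift a (g := fun w => (latticeTime w u v : ℝ))
    (FPP.measurable_latticeTime u v).coe_nnreal_real

lemma meanTime_triangle (h : IIDWeights P τ) (u v x : Fin d → ℤ) :
    meanTime P τ u x ≤ meanTime P τ u v + meanTime P τ v x := by
  unfold meanTime
  rw [← integral_add (h.integrable_latticeTime _ _) (h.integrable_latticeTime _ _)]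
  refine integral_mono (h.integrable_latticeTime _ _)
    ((h.integrable_latticeTime _ _).add (h.integrable_latticeTime _ _)) fun ω => ?_
  exact_mod_cast latticeTime_triangle _ u v x

/-- A common bound for the mean and for the root mean square of the passage times. -/
lemma exists_moment_bound (h : IIDWeights P τ) : ∃ C : ℝ, 0 ≤ C ∧
    (∀ u v : Fin d → ℤ, meanTime P τ u v ≤ C * (∑ i, |u i - v i| : ℤ)) ∧
    ∀ u v : Fin d → ℤ, ∫ ω, (latticeTime (config τ ω) u v : ℝ) ^ 2 ∂P ≤
      C * (∑ i, |u i - v i| : ℤ) ^ 2 := by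
  have := h.isProbabilityMeasure
  -- Without edges there is no reference weight `e₀`, but then all passage times vanish.
  rcases isEmpty_or_nonempty (Edge d) with he | ⟨⟨e₀⟩⟩
  · refine ⟨0, le_rfl, fun u v => ?_, fun u v => ?_⟩ <;>
    · have h0 : ∀ w, latticeTime w u v = 0 := fun w => by
        obtain ⟨E, -, hE⟩ := exists_connectedIn u v
        refine le_antisymm ((hE.latticeTime_le w).trans ?_) zero_le
        rw [Subsingleton.elim E ∅]; simp
      simp [meanTime, h0]
  have hM : ∀ e, ∫ ω, (τ e ω : ℝ) ∂P = ∫ ω, (τ e₀ ω : ℝ) ∂P := fun e =>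
    ((h.ident e e₀).comp (u := fun x : ℝ≥0 => (x : ℝ)) measurable_coe_nnreal_real).integral_eq
  have hQ : ∀ e, ∫ ω, (τ e ω : ℝ) ^ 2 ∂P = ∫ ω, (τ e₀ ω : ℝ) ^ 2 ∂P := fun e =>
    ((h.ident e e₀).comp (u := fun x : ℝ≥0 => (x : ℝ) ^ 2)
      (measurable_coe_nnreal_real.pow_const 2)).integral_eq
  set M := ∫ ω, (τ e₀ ω : ℝ) ∂P
  set Q := ∫ ω, (τ e₀ ω : ℝ) ^ 2 ∂P
  have hM0 : 0 ≤ M := integral_nonneg fun _ => NNReal.coe_nonneg _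
  have hQ0 : 0 ≤ Q := integral_nonneg fun _ => sq_nonneg _
  refine ⟨max M Q, le_max_of_le_left hM0, fun u v => ?_, fun u v => ?_⟩
  · obtain ⟨E, hcard, hE⟩ := exists_connectedIn u v
    have h1 : meanTime P τ u v ≤ ∫ ω, ((∑ e ∈ E, config τ ω e : ℝ≥0) : ℝ) ∂P :=
      integral_mono (h.integrable_latticeTime u v) ((h.memLp_sum E).integrable (by norm_num))
        fun ω => by exact_mod_cast hE.latticeTime_le _
    have h2 : ∫ ω, ((∑ e ∈ E, config τ ω e : ℝ≥0) : ℝ) ∂P = E.card * M := by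
      simp only [NNReal.coe_sum, config]
      rw [integral_finsetSum _ fun e _ => h.integrable e]
      simp [hM]
    have h3 : (E.card : ℝ) ≤ ((∑ i, |u i - v i| : ℤ) : ℝ) := by exact_mod_cast hcard
    calc _ ≤ _ := h1
      _ = _ := h2
      _ ≤ _ * max M Q := mul_le_mul h3 (le_max_left _ _) hM0 ((Nat.cast_nonneg _).trans h3)
      _ = _ := mul_comm _ _
  · obtain ⟨E, hcard, hE⟩ := exists_connectedIn u v
    have hi : Integrable (fun ω => ∑ e ∈ E, (τ e ω : ℝ) ^ 2) P :=
      integrable_finsetSum _ fun e _ => (h.memLp e).integrable_sq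
    have h1 : ∫ ω, (latticeTime (config τ ω) u v : ℝ) ^ 2 ∂P ≤
        ∫ ω, (E.card : ℝ) * ∑ e ∈ E, (τ e ω : ℝ) ^ 2 ∂P := by
      refine integral_mono (h.memLp_latticeTime u v).integrable_sq (hi.const_mul _) fun ω => ?_
      have h2 : (latticeTime (config τ ω) u v : ℝ) ≤ ∑ e ∈ E, (τ e ω : ℝ) := by
        have := hE.latticeTime_le (config τ ω)
        rw [← NNReal.coe_le_coe] at this
        simpa [config] using this
      exact (pow_le_pow_left₀ (NNReal.coe_nonneg _) h2 2).trans sq_sum_le_card_mul_sum_sq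
    have h2 : ∫ ω, (E.card : ℝ) * ∑ e ∈ E, (τ e ω : ℝ) ^ 2 ∂P = (E.card : ℝ) ^ 2 * Q := by
      rw [integral_const_mul, integral_finsetSum _ fun e _ => (h.memLp e).integrable_sq]
      simp [hQ]
      ring
    have h3 : (E.card : ℝ) ≤ ((∑ i, |u i - v i| : ℤ) : ℝ) := by exact_mod_cast hcard
    calc _ ≤ _ := h1
      _ = _ := h2
      _ ≤ _ * max M Q := mul_le_mul (pow_le_pow_left₀ (Nat.cast_nonneg _) h3 2)
        (le_max_right _ _) hQ0 (sq_nonneg _)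
      _ = _ := mul_comm _ _

/-- The passage time is approximated in mean by one that sees only finitely many edges. -/
lemma exists_local_approx (h : IIDWeights P τ) (u v : Fin d → ℤ) :
    ∃ (A : Finset (Edge d)) (g : (Edge d → ℝ≥0) → ℝ≥0), Measurable g ∧
      DependsOn g (A : Set (Edge d)) ∧ (∀ w, latticeTime w u v ≤ g w) ∧
      Integrable (fun ω => (g (config τ ω) : ℝ)) P ∧
      ∫ ω, (g (config τ ω) : ℝ) ∂P ≤ meanTime P τ u v + 1 := by
  classical
  have := h.isProbabilityMeasure
  -- Enumerate the countably many walks. The minimum over the first `n + 1` of them sees finitely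
  -- many edges and decreases to the passage time, and domination by the walk `f 0` gives
  -- convergence of the means.
  obtain ⟨f, hf⟩ := exists_surjective_nat ((lattice d).Walk u v)
  set G : ℕ → (Edge d → ℝ≥0) → ℝ≥0 := fun n w =>
    (Finset.range (n + 1)).inf' (by simp) fun i => pathTime w (f i) with hG
  have hGle : ∀ w, ∀ i n, i ≤ n → G n w ≤ pathTime w (f i) := fun w i n hin =>
    Finset.inf'_le _ (Finset.mem_range.2 (by omega))
  have hle : ∀ n w, latticeTime w u v ≤ G n w := fun n w =>
    Finset.le_inf' _ _ fun i _ => latticeTime_le_pathTime _ _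
  have hGm : ∀ n, Measurable (G n) := fun n => by
    have := Finset.inf'_induction (s := Finset.range (n + 1)) (by simp)
      (fun i (w : Edge d → ℝ≥0) => pathTime w (f i)) (p := Measurable)
      (fun _ ha _ hb => ha.inf hb) fun i _ => measurable_pathTime (f i)
    convert this using 1
    ext w
    simp [hG, Finset.inf'_apply]
  have hlim : ∀ w, Tendsto (fun n => G n w) atTop (𝓝 (latticeTime w u v)) := fun w => by
    have hanti : Antitone fun n => G n w := fun m n hmn =>
      Finset.inf'_mono _ (Finset.range_mono (by omega)) (by simp)
    have := tendsto_atTop_ciInf hanti (OrderBot.bddBelow _)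
    convert this using 2
    refine le_antisymm (le_ciInf fun n => hle n w) (le_latticeTime fun γ => ?_)
    obtain ⟨i, rfl⟩ := hf γ
    exact (ciInf_le (OrderBot.bddBelow _) i).trans (hGle w i i le_rfl)
  have hpt : ∀ {u v : Fin d → ℤ} (γ : (lattice d).Walk u v),
      Integrable (fun ω => (pathTime (config τ ω) γ : ℝ)) P := by
    intro u v γ
    induction γ with
    | nil => simp [pathTime]
    | cons hadj p ih =>
      simp only [pathTime, NNReal.coe_add]
      exact (h.integrable _).add ih
  have hGi : ∀ n, Integrable (fun ω => (G n (config τ ω) : ℝ)) P := fun n => by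
    refine (hpt (f 0)).mono
      ((hGm n).comp h.measurable_config).coe_nnreal_real.aestronglyMeasurable
      (Eventually.of_forall fun ω => ?_)
    simp only [Real.norm_eq_abs, NNReal.abs_eq]
    exact_mod_cast hGle _ 0 n (Nat.zero_le _)
  have hconv : Tendsto (fun n => ∫ ω, (G n (config τ ω) : ℝ) ∂P) atTop (𝓝 (meanTime P τ u v)) := by
    refine tendsto_integral_of_dominated_convergence (fun ω => (pathTime (config τ ω) (f 0) : ℝ))
      (fun n => (hGi n).aestronglyMeasurable) (hpt _) (fun n => Eventually.of_forall fun ω => ?_)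
      (Eventually.of_forall fun ω => ?_)
    · simp only [Real.norm_eq_abs, NNReal.abs_eq]
      exact_mod_cast hGle _ 0 n (Nat.zero_le _)
    · exact (NNReal.continuous_coe.tendsto _).comp (hlim _)
  obtain ⟨n, hn⟩ := (hconv.eventually (gt_mem_nhds (lt_add_one _))).exists
  have hdep : ∀ {u v : Fin d → ℤ} (γ : (lattice d).Walk u v), ∃ A : Finset (Edge d),
      ∀ w w' : Edge d → ℝ≥0, (∀ e ∈ A, w e = w' e) → pathTime w γ = pathTime w' γ := by
    intro u v γ
    induction γ with
    | nil => exact ⟨∅, fun _ _ _ => rfl⟩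
    | cons hadj p ih =>
      obtain ⟨A, hA⟩ := ih
      refine ⟨insert ⟨s(_, _), hadj⟩ A, fun w w' hw => ?_⟩
      simp only [pathTime]
      rw [hw _ (Finset.mem_insert_self _ _),
        hA w w' fun e he => hw e (Finset.mem_insert_of_mem he)]
  choose A hA using fun i => hdep (f i)
  refine ⟨(Finset.range (n + 1)).biUnion A, G n, hGm n, fun w w' hw => ?_, hle n, hGi n, hn.le⟩
  refine Finset.inf'_congr _ rfl fun i hi => hA i w w' fun e he => hw e ?_
  exact_mod_cast Finset.mem_biUnion.2 ⟨i, hi, he⟩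

end IIDWeights

/-! ### Slowly varying functions. -/

section SlowVariation

/-- The uniform convergence theorem for slowly varying functions, in additive form. -/
lemma uniform_of_tendsto_sub {g : ℝ → ℝ} (hg : Measurable g)
    (h : ∀ u, Tendsto (fun x => g (x + u) - g x) atTop (𝓝 0)) {ε : ℝ} (hε : 0 < ε) :
    ∃ X : ℝ, ∀ x ≥ X, ∀ u ∈ Set.Icc (0 : ℝ) 1, |g (x + u) - g x| ≤ ε := by
  by_contra hcon
  push Not at hcon
  choose x hx u hu hbad using fun n : ℕ => hcon n
  have hxtop : Tendsto x atTop atTop :=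
    tendsto_atTop_mono hx tendsto_natCast_atTop_atTop
  -- Pointwise convergence on the bounded interval `[0, 2]` implies convergence in measure. This is
  -- applied with base points `x n` and `x n + u n`.
  have key : ∀ y : ℕ → ℝ, Tendsto y atTop atTop → ∀ᶠ n in atTop,
      volume (Set.Icc (0 : ℝ) 2 ∩ {s | ε / 2 ≤ |g (y n + s) - g (y n)|}) < ENNReal.ofReal (1 / 2) := by
    intro y hy
    have h1 := tendstoInMeasure_of_tendsto_ae (μ := volume.restrict (Set.Icc (0 : ℝ) 2))
      (f := fun n s => g (y n + s) - g (y n)) (g := fun _ => (0 : ℝ))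
      (fun n => ((hg.comp (measurable_const.add measurable_id)).sub
        measurable_const).aestronglyMeasurable)
      (Eventually.of_forall fun s => (h s).comp hy)
    rw [tendstoInMeasure_iff_norm] at h1
    have h2 := (h1 (ε / 2) (by positivity)).eventually
      (gt_mem_nhds (show (0 : ENNReal) < ENNReal.ofReal (1 / 2) by simp))
    filter_upwards [h2] with n hn
    have hm : MeasurableSet {s : ℝ | ε / 2 ≤ |g (y n + s) - g (y n)|} :=
      measurableSet_le measurable_const
        ((hg.comp (measurable_const.add measurable_id)).sub measurable_const).abs
    simp only [sub_zero, Real.norm_eq_abs] at hn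
    rwa [Measure.restrict_apply hm, Set.inter_comm] at hn
  have hy2 : Tendsto (fun n => x n + u n) atTop atTop :=
    tendsto_atTop_mono (fun n => le_add_of_nonneg_right (hu n).1) hxtop
  obtain ⟨n, hn1, hn2⟩ := ((key x hxtop).and (key _ hy2)).exists
  set A := Set.Icc (0 : ℝ) 2 ∩ {s | ε / 2 ≤ |g (x n + s) - g (x n)|}
  set B := Set.Icc (0 : ℝ) 2 ∩ {s | ε / 2 ≤ |g (x n + u n + s) - g (x n + u n)|}
  have hvol : volume (A ∪ (fun s => s + -(u n)) ⁻¹' B) < volume (Set.Icc (1 : ℝ) 2) := by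
    calc volume (A ∪ (fun s => s + -(u n)) ⁻¹' B)
        ≤ volume A + volume ((fun s => s + -(u n)) ⁻¹' B) := measure_union_le _ _
      _ = volume A + volume B := by rw [measure_preimage_add_right]
      _ < ENNReal.ofReal (1 / 2) + ENNReal.ofReal (1 / 2) := ENNReal.add_lt_add hn1 hn2
      _ = volume (Set.Icc (1 : ℝ) 2) := by
        rw [← ENNReal.ofReal_add (by norm_num) (by norm_num), Real.volume_Icc]
        norm_num
  -- The two bad sets have total measure below 1, so some `s` in `[1, 2]` avoids both. As `s - u n`
  -- lies in `[0, 2]`, comparing `g (x n)` and `g (x n + u n)` with `g (x n + s)` contradicts the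
  -- choice of `u n`.
  have hex : ∃ s ∈ Set.Icc (1 : ℝ) 2, s ∉ A ∪ (fun s => s + -(u n)) ⁻¹' B := by
    by_contra hc
    push Not at hc
    exact absurd (measure_mono hc) (not_le.2 hvol)
  obtain ⟨s, hs, hsn⟩ := hex
  have hun := hu n
  have hA : |g (x n + s) - g (x n)| < ε / 2 := by
    by_contra hc
    exact hsn (Or.inl ⟨⟨by linarith [hs.1], hs.2⟩, not_lt.1 hc⟩)
  have hB : |g (x n + u n + (s + -(u n))) - g (x n + u n)| < ε / 2 := by
    by_contra hc
    exact hsn (Or.inr ⟨⟨by linarith [hs.1, hun.2], by linarith [hs.2, hun.1]⟩, not_lt.1 hc⟩)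
  have e1 : x n + u n + (s + -(u n)) = x n + s := by ring
  rw [e1] at hB
  have := hbad n
  rw [abs_lt] at hA hB
  rcases lt_abs.1 this with h3 | h3 <;> linarith [hA.1, hA.2, hB.1, hB.2]

/-- By uniform convergence, `g` changes by at most `ε / 2` over each unit step beyond some `X`, so
it grows sublinearly. -/
lemma tendsto_div_self_of_tendsto_sub {g : ℝ → ℝ} (hg : Measurable g)
    (h : ∀ u, Tendsto (fun x => g (x + u) - g x) atTop (𝓝 0)) :
    Tendsto (fun x => g x / x) atTop (𝓝 0) := by
  rw [Metric.tendsto_nhds]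
  intro ε hε
  obtain ⟨X, hX⟩ := uniform_of_tendsto_sub hg h (half_pos hε)
  have step : ∀ n : ℕ, ∀ u ∈ Set.Icc (0 : ℝ) 1, |g (X + u + n) - g X| ≤ ε / 2 * (n + 1) := by
    intro n u hu
    induction n with
    | zero => simpa using hX X le_rfl u hu
    | succ n ih =>
      have h1 := hX (X + u + n) (by have := hu.1; have : (0 : ℝ) ≤ n := n.cast_nonneg; linarith) 1
        (by simp)
      push_cast
      rw [← add_assoc]
      calc _ ≤ |g (X + u + n + 1) - g (X + u + n)| + |g (X + u + n) - g X| := abs_sub_le _ _ _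
        _ ≤ _ := by linarith
  have hlim : Tendsto (fun x : ℝ => (|g X| + ε / 2 * (1 - X)) / x) atTop (𝓝 0) :=
    tendsto_const_nhds.div_atTop tendsto_id
  filter_upwards [hlim.eventually (gt_mem_nhds (half_pos hε)), eventually_ge_atTop X,
    eventually_gt_atTop 0] with x hx1 hx2 hx3
  have h0 : 0 ≤ x - X := by linarith
  have h1 := step ⌊x - X⌋₊ (x - X - ⌊x - X⌋₊)
    ⟨by linarith [Nat.floor_le h0], by linarith [Nat.lt_floor_add_one (x - X)]⟩
  have e1 : X + (x - X - ⌊x - X⌋₊) + ⌊x - X⌋₊ = x := by ring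
  rw [e1] at h1
  have h2 : |g x| ≤ |g X| + ε / 2 * (1 - X) + ε / 2 * x := by
    have h3 : |g x| ≤ |g x - g X| + |g X| := by
      simpa using abs_sub_le (g x) (g X) 0
    nlinarith [Nat.floor_le h0]
  rw [Real.dist_eq, sub_zero, abs_div, abs_of_pos hx3, div_lt_iff₀ hx3]
  rw [div_lt_iff₀ hx3] at hx1
  linarith

/-- In logarithmic coordinates, `g(x) = log f(eˣ)` has increments tending to zero. -/
lemma SlowlyVarying.tendsto_log_div_log {f : ℝ → ℝ} (hf : SlowlyVarying f) :
    Tendsto (fun t => Real.log (f t) / Real.log t) atTop (𝓝 0) := by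
  have hm : Measurable fun x : ℝ => Real.log (f (Real.exp x)) := by
    have h1 : Measurable fun x : ℝ => (⟨Real.exp x, Real.exp_pos x⟩ : Set.Ioi (0 : ℝ)) :=
      Real.measurable_exp.subtype_mk
    exact Real.measurable_log.comp (hf.measurable.comp h1)
  have h1 : ∀ u, Tendsto (fun x => Real.log (f (Real.exp (x + u))) - Real.log (f (Real.exp x)))
      atTop (𝓝 0) := by
    intro u
    have h2 := (hf.tendsto (Real.exp u) (Real.exp_pos u)).comp Real.tendsto_exp_atTop
    have h3 := h2.log one_ne_zero
    rw [Real.log_one] at h3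
    refine h3.congr fun x => ?_
    simp only [Function.comp_apply]
    rw [Real.log_div (hf.pos _ (by positivity)).ne' (hf.pos _ (by positivity)).ne', Real.exp_add,
      mul_comm]
  refine ((tendsto_div_self_of_tendsto_sub hm h1).comp Real.tendsto_log_atTop).congr' ?_
  filter_upwards [eventually_gt_atTop 0] with t ht
  simp [Real.exp_log ht]

lemma SlowlyVarying.eventually_rpow_bounds {f : ℝ → ℝ} (hf : SlowlyVarying f) {δ : ℝ}
    (hδ : 0 < δ) : ∀ᶠ t in atTop, t ^ (-δ) ≤ f t ∧ f t ≤ t ^ δ := by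
  have h := hf.tendsto_log_div_log
  have h' := (h.eventually (lt_mem_nhds (neg_lt_zero.2 hδ))).and (h.eventually (gt_mem_nhds hδ))
  filter_upwards [h', eventually_gt_atTop 1] with t ⟨h1, h2⟩ ht
  have ht0 : 0 < t := by linarith
  have hl := Real.log_pos ht
  rw [lt_div_iff₀ hl] at h1
  rw [div_lt_iff₀ hl] at h2
  constructor
  · rw [← Real.log_le_log_iff (by positivity) (hf.pos t ht0), Real.log_rpow ht0]
    exact h1.le
  · rw [← Real.log_le_log_iff (hf.pos t ht0) (by positivity), Real.log_rpow ht0]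
    exact h2.le

/-- The prefactors `c₁` and `c₂` do not matter on the exponential scale: `log c = o(log t)`, while
`b(t) t^r` eventually dominates `t^(r/2)`. -/
lemma tendsto_log_div_mul_rpow {b c : ℝ → ℝ} (hb : SlowlyVarying b) (hc : SlowlyVarying c) {r : ℝ}
    (hr : 0 < r) : Tendsto (fun t => Real.log (c t) / (b t * t ^ r)) atTop (𝓝 0) := by
  have h1 : Tendsto (fun t : ℝ => Real.log t / (b t * t ^ r)) atTop (𝓝 0) := by
    have h2 := (isLittleO_log_rpow_atTop (half_pos hr)).tendsto_div_nhds_zero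
    refine squeeze_zero' ?_ ?_ h2
    · filter_upwards [eventually_ge_atTop 1] with t ht
      have := hb.pos t (by linarith)
      have := Real.log_nonneg ht
      positivity
    · filter_upwards [hb.eventually_rpow_bounds (half_pos hr), eventually_ge_atTop 1] with t h3 ht
      have ht0 : 0 < t := by linarith
      refine div_le_div_of_nonneg_left (Real.log_nonneg ht) (by positivity) ?_
      calc t ^ (r / 2) = t ^ (-(r / 2)) * t ^ r := by
            rw [← Real.rpow_add ht0]; congr 1; ring
        _ ≤ _ := mul_le_mul_of_nonneg_right h3.1 (by positivity)
  have h3 := hc.tendsto_log_div_log.mul h1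
  rw [zero_mul] at h3
  refine h3.congr' ?_
  filter_upwards [eventually_gt_atTop 1] with t ht
  have := (Real.log_pos ht).ne'
  rw [div_mul_div_comm, mul_comm (Real.log t), mul_div_mul_right _ _ this]

end SlowVariation

/-- The properties of `h(t) = -log ℙ(τ > t)` that enter in the large deviation estimates: `h` is
monotone and regularly varying with index `r < 1`. -/
structure RegularTail (h : ℝ → ℝ) (r : ℝ) : Prop where
  mono : Monotone h
  nonneg : ∀ t, 0 ≤ h t
  tendsto_ratio : ∀ a, 0 < a → Tendsto (fun t => h (a * t) / h t) atTop (𝓝 (a ^ r))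
  rpow_le : ∀ᶠ t in atTop, t ^ (r / 2) ≤ h t
  tendsto_div : Tendsto (fun t => h t / t) atTop (𝓝 0)

/-! ### From the tail hypotheses to regular variation. -/

section Tail

variable {r : ℝ} {c₁ c₂ b₁ b₂ p : ℝ → ℝ}

lemma tendsto_neg_log_div (hr0 : 0 < r)
    (hc₁ : SlowlyVarying c₁) (hc₂ : SlowlyVarying c₂) (hb₁ : SlowlyVarying b₁)
    (hb : Tendsto (fun t : ℝ => b₁ t / b₂ t) atTop (𝓝 1))
    (hlower : ∀ t : ℝ, 0 < t → c₁ t * Real.exp (-(b₁ t * t ^ r)) ≤ p t)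
    (hupper : ∀ t : ℝ, 0 < t → p t ≤ c₂ t * Real.exp (-(b₂ t * t ^ r))) :
    Tendsto (fun t => -Real.log (p t) / (b₁ t * t ^ r)) atTop (𝓝 1) := by
  have hlo : Tendsto (fun t => b₂ t / b₁ t - Real.log (c₂ t) / (b₁ t * t ^ r)) atTop (𝓝 1) := by
    have h1 := (hb.inv₀ one_ne_zero).sub (tendsto_log_div_mul_rpow hb₁ hc₂ hr0)
    simpa using h1
  have hup : Tendsto (fun t => 1 - Real.log (c₁ t) / (b₁ t * t ^ r)) atTop (𝓝 1) := by
    have h1 := (tendsto_const_nhds (x := (1 : ℝ))).sub (tendsto_log_div_mul_rpow hb₁ hc₁ hr0)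
    simpa using h1
  have hpos : ∀ t, 0 < t → 0 < p t := fun t ht =>
    (mul_pos (hc₁.pos t ht) (Real.exp_pos _)).trans_le (hlower t ht)
  refine tendsto_of_tendsto_of_tendsto_of_le_of_le' hlo hup ?_ ?_
  · filter_upwards [eventually_gt_atTop 0] with t ht
    have hb1 := hb₁.pos t ht
    have htr : 0 < t ^ r := by positivity
    have h1 := Real.log_le_log (hpos t ht) (hupper t ht)
    rw [Real.log_mul (hc₂.pos t ht).ne' (Real.exp_pos _).ne', Real.log_exp] at h1
    rw [le_div_iff₀ (by positivity), sub_mul, div_mul_cancel₀ _ (by positivity)]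
    have : b₂ t / b₁ t * (b₁ t * t ^ r) = b₂ t * t ^ r := by field_simp
    linarith
  · filter_upwards [eventually_gt_atTop 0] with t ht
    have hb1 := hb₁.pos t ht
    have htr : 0 < t ^ r := by positivity
    have h1 := Real.log_le_log (mul_pos (hc₁.pos t ht) (Real.exp_pos _)) (hlower t ht)
    rw [Real.log_mul (hc₁.pos t ht).ne' (Real.exp_pos _).ne', Real.log_exp] at h1
    rw [div_le_iff₀ (by positivity), sub_mul, div_mul_cancel₀ _ (by positivity)]
    linarith

lemma regularTail_neg_log (hr0 : 0 < r) (hr1 : r < 1)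
    (hc₁ : SlowlyVarying c₁) (hc₂ : SlowlyVarying c₂) (hb₁ : SlowlyVarying b₁)
    (hb : Tendsto (fun t : ℝ => b₁ t / b₂ t) atTop (𝓝 1))
    (hlower : ∀ t : ℝ, 0 < t → c₁ t * Real.exp (-(b₁ t * t ^ r)) ≤ p t)
    (hupper : ∀ t : ℝ, 0 < t → p t ≤ c₂ t * Real.exp (-(b₂ t * t ^ r)))
    (hanti : Antitone p) (hp1 : ∀ t, p t ≤ 1) :
    RegularTail (fun t => -Real.log (p t)) r := by
  have hpos : ∀ t, 0 < p t := fun t => by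
    have h1 : 0 < max t 1 := lt_max_of_lt_right one_pos
    exact ((mul_pos (hc₁.pos _ h1) (Real.exp_pos _)).trans_le (hlower _ h1)).trans_le
      (hanti (le_max_left _ _))
  have hlim := tendsto_neg_log_div hr0 hc₁ hc₂ hb₁ hb hlower hupper
  refine ⟨fun s t hst => ?_, fun t => ?_, fun a ha => ?_, ?_, ?_⟩
  · exact neg_le_neg (Real.log_le_log (hpos t) (hanti hst))
  · have := Real.log_nonpos (hpos t).le (hp1 t)
    exact neg_nonneg.2 this
  · have hat : Tendsto (fun t : ℝ => a * t) atTop atTop := tendsto_id.const_mul_atTop ha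
    have h1 := ((hlim.comp hat).mul (hb₁.tendsto a ha)).mul_const (a ^ r)
    have h2 := h1.div hlim one_ne_zero
    simp only [mul_one, one_mul, div_one] at h2
    refine h2.congr' ?_
    filter_upwards [eventually_gt_atTop 0] with t ht
    have hb1 := hb₁.pos t ht
    have hb2 := hb₁.pos (a * t) (by positivity)
    have htr : 0 < t ^ r := by positivity
    have har : 0 < a ^ r := by positivity
    simp only [Pi.div_apply, Function.comp_apply]
    rw [Real.mul_rpow ha.le ht.le]
    -- If the denominator vanishes, both sides are zero by the convention for division.
    by_cases h0 : Real.log (p t) = 0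
    · simp [h0]
    · field_simp
  · have h4 : (0 : ℝ) < r / 4 := by positivity
    filter_upwards [hlim.eventually (lt_mem_nhds (show (1 / 2 : ℝ) < 1 by norm_num)),
      hb₁.eventually_rpow_bounds h4, eventually_gt_atTop 0,
      (tendsto_rpow_atTop h4).eventually_ge_atTop 2] with t h1 h2 h3 h5
    have hb1 := hb₁.pos t h3
    have htr : 0 < t ^ r := by positivity
    rw [lt_div_iff₀ (by positivity)] at h1
    have e1 : t ^ (-(r / 4)) * t ^ r = t ^ (r / 4) * t ^ (r / 2) := by
      rw [← Real.rpow_add h3, ← Real.rpow_add h3]; congr 1; ring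
    have h6 := mul_le_mul_of_nonneg_right h2.1 htr.le
    have h7 : 0 < t ^ (r / 2) := by positivity
    nlinarith
  · have h4 : (0 : ℝ) < (1 - r) / 2 := by linarith
    have h5 : Tendsto (fun t : ℝ => 2 * t ^ (-((1 - r) / 2))) atTop (𝓝 0) := by
      simpa using (tendsto_rpow_neg_atTop h4).const_mul 2
    refine squeeze_zero' ?_ ?_ h5
    · filter_upwards [eventually_gt_atTop 0] with t ht
      have := Real.log_nonpos (hpos t).le (hp1 t)
      exact div_nonneg (by linarith) ht.le
    · filter_upwards [hlim.eventually (gt_mem_nhds (show (1 : ℝ) < 2 by norm_num)),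
        hb₁.eventually_rpow_bounds h4, eventually_gt_atTop 0] with t h1 h2 h3
      have hb1 := hb₁.pos t h3
      have htr : 0 < t ^ r := by positivity
      rw [div_lt_iff₀ (by positivity)] at h1
      rw [div_le_iff₀ h3]
      have e1 : t ^ ((1 - r) / 2) * t ^ r = t ^ (-((1 - r) / 2)) * t := by
        nth_rewrite 4 [← Real.rpow_one t]
        rw [← Real.rpow_add h3, ← Real.rpow_add h3]; congr 1; ring
      have h6 := mul_le_mul_of_nonneg_right h2.2 htr.le
      linarith

end Tail

namespace RegularTail

variable {h : ℝ → ℝ} {r : ℝ}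

lemma tendsto_atTop (H : RegularTail h r) (hr : 0 < r) : Tendsto h atTop atTop :=
  tendsto_atTop_mono' _ H.rpow_le (tendsto_rpow_atTop (half_pos hr))

/-- `h(t) / t` is almost decreasing. -/
lemma exists_div_le (H : RegularTail h r) (hr : 0 < r) (hr1 : r < 1) {a : ℝ} (ha : 1 < a) :
    ∃ u₀ > 0, ∀ u s, u₀ ≤ u → u ≤ s → h s * u ≤ a * (s * h u) := by
  have h1 : a ^ r < a := by
    nth_rewrite 2 [← Real.rpow_one a]
    exact Real.rpow_lt_rpow_of_exponent_lt ha hr1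
  -- The limit of the ratio is `a ^ r < a`; here `r < 1` enters. The bound is then iterated along
  -- the powers of `a`.
  have h2 : ∀ᶠ t in atTop, h (a * t) ≤ a * h t := by
    filter_upwards [(H.tendsto_ratio a (by linarith)).eventually (gt_mem_nhds h1),
      (H.tendsto_atTop hr).eventually_gt_atTop 0] with t ht h0
    exact ((div_lt_iff₀ h0).1 ht).le
  obtain ⟨u₁, hu₁⟩ := eventually_atTop.1 h2
  refine ⟨max u₁ 1, lt_max_of_lt_right one_pos, fun u s hu hs => ?_⟩
  have hu0 : 0 < u := (lt_max_of_lt_right one_pos).trans_le hu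
  have ha0 : 0 < a := by linarith
  have h3 : ∀ k : ℕ, h (a ^ k * u) ≤ a ^ k * h u := by
    intro k
    induction k with
    | zero => simp
    | succ k ih =>
      have h4 : u₁ ≤ a ^ k * u := by
        have : 1 ≤ a ^ k := one_le_pow₀ ha.le
        have := le_mul_of_one_le_left hu0.le this
        exact ((le_max_left _ _).trans hu).trans this
      calc h (a ^ (k + 1) * u) = h (a * (a ^ k * u)) := by congr 1; ring
        _ ≤ a * h (a ^ k * u) := hu₁ _ h4
        _ ≤ a * (a ^ k * h u) := mul_le_mul_of_nonneg_left ih ha0.le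
        _ = _ := by ring
  -- Locate `s / u` between consecutive powers of `a`; passing to the larger one by monotonicity
  -- costs the factor `a` in the conclusion.
  obtain ⟨k, hk1, hk2⟩ := exists_nat_pow_near ((one_le_div hu0).2 hs) ha
  rw [le_div_iff₀ hu0] at hk1
  rw [div_lt_iff₀ hu0] at hk2
  have h5 := (H.mono hk2.le).trans (h3 (k + 1))
  calc h s * u ≤ a ^ (k + 1) * h u * u := mul_le_mul_of_nonneg_right h5 hu0.le
    _ = a * ((a ^ k * u) * h u) := by ring
    _ ≤ _ := mul_le_mul_of_nonneg_left (mul_le_mul_of_nonneg_right hk1 (H.nonneg u)) ha0.le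

end RegularTail

/-! ### Moments from the tail by the layer cake formula. -/

section LayerCake

variable {P : Measure Ω} {h : ℝ → ℝ} {r : ℝ}

/-- Since `h` dominates `t^(r/2)`, the exponential beats every power. This makes tail integrals
converge and absorbs polynomial factors from union bounds. -/
lemma RegularTail.eventually_exp_le (H : RegularTail h r) (hr : 0 < r) {c : ℝ} (hc : 0 < c) (m : ℝ) :
    ∀ᶠ t in atTop, Real.exp (-(c * h t)) ≤ t ^ (-m) := by
  have h1 := (isLittleO_exp_neg_mul_rpow_atTop hc (-(2 * m / r))).comp_tendsto
    (tendsto_rpow_atTop (half_pos hr))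
  filter_upwards [h1.bound one_pos, H.rpow_le, eventually_gt_atTop 0] with t h2 h3 h4
  simp only [Function.comp_apply, Real.norm_eq_abs, Real.abs_exp, one_mul] at h2
  rw [abs_of_pos (by positivity), ← Real.rpow_mul h4.le] at h2
  have e1 : r / 2 * -(2 * m / r) = -m := by field_simp
  rw [e1] at h2
  refine le_trans (Real.exp_le_exp.2 ?_) h2
  nlinarith

lemma memLp_two_of_tail [IsProbabilityMeasure P] (H : RegularTail h r) (hr : 0 < r) {X : Ω → ℝ≥0}
    (hX : Measurable X) (htail : ∀ t, P.real {ω | t < (X ω : ℝ)} = Real.exp (-h t)) :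
    MemLp (fun ω => (X ω : ℝ)) 2 P := by
  have hXr : Measurable fun ω => (X ω : ℝ) := hX.coe_nnreal_real
  rw [memLp_two_iff_integrable_sq hXr.aestronglyMeasurable]
  refine ⟨(hXr.pow_const 2).aestronglyMeasurable, ?_⟩
  rw [hasFiniteIntegral_iff_ofReal (Eventually.of_forall fun ω => by positivity)]
  have h1 := lintegral_comp_eq_lintegral_meas_lt_mul P (f := fun ω => (X ω : ℝ))
    (g := fun t => 2 * t) (Eventually.of_forall fun ω => NNReal.coe_nonneg _) hXr.aemeasurable
    (fun t _ => (continuous_const.mul continuous_id).intervalIntegrable _ _)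
    (by
      refine (ae_restrict_iff' measurableSet_Ioi).2 (Eventually.of_forall fun t ht => ?_)
      have : (0 : ℝ) < t := ht
      positivity)
  have h2 : ∀ x : ℝ, ∫ t in (0 : ℝ)..x, 2 * t = x ^ 2 := fun x => by
    rw [intervalIntegral.integral_const_mul, integral_id]; ring
  simp only [h2] at h1
  rw [h1]
  obtain ⟨T, hT⟩ := eventually_atTop.1 (H.eventually_exp_le hr one_pos 3)
  set T' := max T 1
  have hT' : 0 < T' := lt_max_of_lt_right one_pos
  rw [← Set.Ioc_union_Ioi_eq_Ioi hT'.le]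
  refine (lintegral_union_le _ _ _).trans_lt (ENNReal.add_lt_top.2 ⟨?_, ?_⟩)
  · calc ∫⁻ t in Set.Ioc 0 T', P {ω | t < (X ω : ℝ)} * ENNReal.ofReal (2 * t)
        ≤ ∫⁻ _ in Set.Ioc 0 T', ENNReal.ofReal (2 * T') := by
          refine setLIntegral_mono measurable_const fun t ht => ?_
          calc _ ≤ 1 * ENNReal.ofReal (2 * T') :=
                mul_le_mul' prob_le_one (ENNReal.ofReal_le_ofReal (by linarith [ht.2]))
            _ = _ := one_mul _
      _ < ⊤ := by
          rw [setLIntegral_const, Real.volume_Ioc]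
          exact ENNReal.mul_lt_top ENNReal.ofReal_lt_top ENNReal.ofReal_lt_top
  · have h3 : IntegrableOn (fun t : ℝ => 2 * t ^ (-2 : ℝ)) (Set.Ioi T') :=
      (integrableOn_Ioi_rpow_of_lt (by norm_num) hT').const_mul 2
    refine lt_of_le_of_lt ?_ h3.lintegral_lt_top
    refine setLIntegral_mono_ae' measurableSet_Ioi (Eventually.of_forall fun t ht => ?_)
    have ht1 : T' < t := ht
    have ht0 : 0 < t := hT'.trans ht1
    have h4 : P {ω | t < (X ω : ℝ)} = ENNReal.ofReal (Real.exp (-h t)) := by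
      rw [← htail t, ofReal_measureReal]
    rw [h4, ← ENNReal.ofReal_mul (Real.exp_pos _).le]
    refine ENNReal.ofReal_le_ofReal ?_
    have h5 := hT t ((le_max_left _ _).trans ht1.le)
    rw [one_mul] at h5
    calc Real.exp (-h t) * (2 * t) ≤ t ^ (-3 : ℝ) * (2 * t) :=
          mul_le_mul_of_nonneg_right h5 (by positivity)
      _ = 2 * (t ^ (-3 : ℝ) * t ^ (1 : ℝ)) := by rw [Real.rpow_one]; ring
      _ = _ := by rw [← Real.rpow_add ht0]; norm_num

/-- The exponential moment of a variable with a regular tail, truncated at `s`, at the critical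
parameter `(1 - η) h(s) / s`. -/
lemma exists_truncated_exp_moment [IsProbabilityMeasure P] (H : RegularTail h r) (hr : 0 < r)
    (hr1 : r < 1) {η : ℝ} (hη : 0 < η) (hη1 : η < 1) :
    ∃ C : ℝ, 0 < C ∧ ∀ᶠ s in atTop, ∀ X : Ω → ℝ≥0, Measurable X →
      (∀ t, P.real {ω | t < (X ω : ℝ)} = Real.exp (-h t)) →
      Integrable (fun ω => Real.exp ((1 - η) * h s / s * if (X ω : ℝ) ≤ s then (X ω : ℝ) else 0)) P ∧
      ∫ ω, Real.exp ((1 - η) * h s / s * if (X ω : ℝ) ≤ s then (X ω : ℝ) else 0) ∂P ≤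
        1 + (1 - η) * h s / s * C := by
  have hη' : 0 < 1 - η := by linarith
  -- With this loss factor in `exists_div_le`, the parameter `l = (1 - η) h(s) / s` satisfies `l t ≤
  -- (1 - η / 2) h(t)` for `u₀ < t < s`, which leaves `exp(-(η / 2) h(t))` for integrability.
  have ha : 1 < (1 - η / 2) / (1 - η) := by rw [one_lt_div hη']; linarith
  obtain ⟨u₁, hu₁, hdiv⟩ := H.exists_div_le hr hr1 ha
  obtain ⟨T, hT⟩ := eventually_atTop.1 (H.eventually_exp_le hr (half_pos hη) 2)
  set u₀ := max u₁ T with hu₀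
  have hu₀p : 0 < u₀ := hu₁.trans_le (le_max_left _ _)
  have hI : IntegrableOn (fun t : ℝ => t ^ (-2 : ℝ)) (Set.Ioi u₀) :=
    integrableOn_Ioi_rpow_of_lt (by norm_num) hu₀p
  set K := ∫ t in Set.Ioi u₀, t ^ (-2 : ℝ)
  have hK : 0 ≤ K := setIntegral_nonneg measurableSet_Ioi fun t ht =>
    Real.rpow_nonneg (hu₀p.trans ht).le _
  -- The first term bounds the contribution of `t ≤ u₀`, where `l ≤ 1`; the second that of `t > u₀`,
  -- where the integrand is at most `l t⁻²`.
  refine ⟨u₀ * Real.exp u₀ + K, by positivity, ?_⟩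
  filter_upwards [H.tendsto_div.eventually (gt_mem_nhds one_pos), eventually_gt_atTop 0]
    with s hs1 hs0 X hX htail
  set l := (1 - η) * h s / s with hl
  have hl0 : 0 ≤ l := div_nonneg (mul_nonneg hη'.le (H.nonneg s)) hs0.le
  have hl1 : l ≤ 1 := by
    have : l = (1 - η) * (h s / s) := by rw [hl]; ring
    have := div_nonneg (H.nonneg s) hs0.le
    nlinarith
  set Y : Ω → ℝ := fun ω => if (X ω : ℝ) ≤ s then (X ω : ℝ) else 0 with hY
  have hXr : Measurable fun ω => (X ω : ℝ) := hX.coe_nnreal_real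
  have hYm : Measurable Y := Measurable.ite (measurableSet_le hXr measurable_const) hXr
    measurable_const
  have hY0 : ∀ ω, 0 ≤ Y ω := fun ω => by
    simp only [hY]; split_ifs <;> simp
  have hYs : ∀ ω, Y ω ≤ s := fun ω => by
    simp only [hY]; split_ifs <;> linarith
  have hYX : ∀ ω, Y ω ≤ X ω := fun ω => by
    simp only [hY]; split_ifs <;> simp
  have hint : Integrable (fun ω => Real.exp (l * Y ω)) P := by
    refine Integrable.of_bound (Real.measurable_exp.comp (hYm.const_mul l)).aestronglyMeasurable
      (Real.exp (l * s)) (Eventually.of_forall fun ω => ?_)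
    rw [Real.norm_eq_abs, Real.abs_exp]
    exact Real.exp_le_exp.2 (mul_le_mul_of_nonneg_left (hYs ω) hl0)
  refine ⟨hint, ?_⟩
  have h1 := lintegral_comp_eq_lintegral_meas_lt_mul P (f := Y)
    (g := fun t => l * Real.exp (l * t)) (Eventually.of_forall hY0) hYm.aemeasurable
    (fun t _ => Continuous.intervalIntegrable (by fun_prop) _ _)
    (Eventually.of_forall fun t => by positivity)
  have h2 : ∀ x : ℝ, ∫ t in (0 : ℝ)..x, l * Real.exp (l * t) = Real.exp (l * x) - 1 := fun x => by
    rw [intervalIntegral.integral_eq_sub_of_hasDerivAt (f := fun t => Real.exp (l * t))]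
    · simp
    · intro t _
      have := ((hasDerivAt_id t).const_mul l).exp
      simpa [mul_comm] using this
    · exact Continuous.intervalIntegrable (by fun_prop) _ _
  simp only [h2] at h1
  have hP : ∀ t, P {ω | t < Y ω} ≤ ENNReal.ofReal (Real.exp (-h t)) := fun t => by
    rw [← htail t, ofReal_measureReal]
    exact measure_mono fun ω hω => lt_of_lt_of_le hω (hYX ω)
  have h3 : ∫⁻ t in Set.Ioi 0, P {ω | t < Y ω} * ENNReal.ofReal (l * Real.exp (l * t)) ≤
      ENNReal.ofReal (l * (u₀ * Real.exp u₀ + K)) := by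
    rw [← Set.Ioc_union_Ioi_eq_Ioi hu₀p.le, mul_add, ENNReal.ofReal_add (by positivity)
      (by positivity)]
    refine (lintegral_union_le _ _ _).trans (add_le_add ?_ ?_)
    · calc ∫⁻ t in Set.Ioc 0 u₀, P {ω | t < Y ω} * ENNReal.ofReal (l * Real.exp (l * t))
          ≤ ∫⁻ _ in Set.Ioc 0 u₀, ENNReal.ofReal (l * Real.exp u₀) := by
            refine setLIntegral_mono measurable_const fun t ht => ?_
            calc _ ≤ 1 * ENNReal.ofReal (l * Real.exp u₀) := by
                  refine mul_le_mul' prob_le_one (ENNReal.ofReal_le_ofReal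
                    (mul_le_mul_of_nonneg_left (Real.exp_le_exp.2 ?_) hl0))
                  nlinarith [ht.1, ht.2]
              _ = _ := one_mul _
        _ = ENNReal.ofReal (l * (u₀ * Real.exp u₀)) := by
            rw [setLIntegral_const, Real.volume_Ioc, ← ENNReal.ofReal_mul (by positivity)]
            congr 1
            ring
    · calc ∫⁻ t in Set.Ioi u₀, P {ω | t < Y ω} * ENNReal.ofReal (l * Real.exp (l * t))
          ≤ ∫⁻ t in Set.Ioi u₀, ENNReal.ofReal (l * t ^ (-2 : ℝ)) := by
            refine setLIntegral_mono_ae' measurableSet_Ioi (Eventually.of_forall fun t ht => ?_)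
            have ht1 : u₀ < t := ht
            have ht0 : 0 < t := hu₀p.trans ht1
            rcases lt_or_ge t s with hts | hts
            · refine (mul_le_mul' (hP t) le_rfl).trans ?_
              rw [← ENNReal.ofReal_mul (Real.exp_pos _).le]
              refine ENNReal.ofReal_le_ofReal ?_
              have h4 := hT t ((le_max_right _ _).trans ht1.le)
              have h5 := hdiv t s ((le_max_left _ _).trans ht1.le) hts.le
              have h6 : l * t ≤ (1 - η / 2) * h t := by
                have h7 : (1 - η) * (h s * t) ≤ (1 - η / 2) * (s * h t) := by
                  have := mul_le_mul_of_nonneg_left h5 hη'.le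
                  have e1 : (1 - η) * ((1 - η / 2) / (1 - η) * (s * h t)) =
                      (1 - η / 2) * (s * h t) := by field_simp
                  linarith
                rw [hl, div_mul_eq_mul_div, div_le_iff₀ hs0]
                linarith
              calc Real.exp (-h t) * (l * Real.exp (l * t))
                  = l * Real.exp (-h t + l * t) := by rw [Real.exp_add]; ring
                _ ≤ l * Real.exp (-(η / 2 * h t)) :=
                  mul_le_mul_of_nonneg_left (Real.exp_le_exp.2 (by linarith)) hl0
                _ ≤ _ := mul_le_mul_of_nonneg_left h4 hl0
            · have : {ω | t < Y ω} = ∅ := by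
                ext ω
                simpa using (hYs ω).trans hts
              rw [this]
              simp
        _ = ENNReal.ofReal (l * K) := by
            rw [← ofReal_integral_eq_lintegral_ofReal (hI.const_mul l)
              ((ae_restrict_iff' measurableSet_Ioi).2 (Eventually.of_forall fun t ht =>
                mul_nonneg hl0 (Real.rpow_nonneg (hu₀p.trans ht).le _))), integral_const_mul]
  have h4 : ∫ ω, (Real.exp (l * Y ω) - 1) ∂P ≤ l * (u₀ * Real.exp u₀ + K) := by
    have hsm : AEStronglyMeasurable (fun ω => Real.exp (l * Y ω) - 1) P :=
      (hint.sub (integrable_const _)).aestronglyMeasurable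
    rw [integral_eq_lintegral_of_nonneg_ae (Eventually.of_forall fun ω => ?_) hsm]
    · refine ENNReal.toReal_le_of_le_ofReal (by positivity) ?_
      rw [h1]
      exact h3
    · have := Real.one_le_exp (mul_nonneg hl0 (hY0 ω))
      simp only [Pi.zero_apply]
      linarith
  rw [integral_sub hint (integrable_const _)] at h4
  simp at h4
  linarith

end LayerCake

/-! ### One big jump. -/

section BigJump

variable {ι : Type*} {P : Measure Ω} {h : ℝ → ℝ} {r : ℝ} {τ : ι → Ω → ℝ≥0}

/-- One big jump: a sum of few independent variables with a regular tail exceeds `s` with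
essentially the probability that one of them does. -/
lemma exists_sum_tail_le (H : RegularTail h r) (hr : 0 < r) (hr1 : r < 1)
    (hm : ∀ e, Measurable (τ e)) (hi : iIndepFun τ P)
    (htail : ∀ e t, P.real {ω | t < (τ e ω : ℝ)} = Real.exp (-h t)) {θ : ℝ} (hθ0 : 0 < θ)
    (hθ : θ < 1) :
    ∃ ε > 0, ∀ᶠ s : ℝ in atTop, ∀ E : Finset ι, (E.card : ℝ) ≤ ε * s →
      P.real {ω | s ≤ ∑ e ∈ E, (τ e ω : ℝ)} ≤ Real.exp (-(θ * h s)) := by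
  have := hi.isProbabilityMeasure
  -- This choice gives `(1 - η)² ≥ (1 + θ) / 2`: one factor comes from the parameter `l`, the other
  -- from the at most `η s / C` summands in Chernoff's bound.
  set η := (1 - θ) / 4 with hη
  obtain ⟨C, hC, hmom⟩ := exists_truncated_exp_moment (P := P) H hr hr1
    (show 0 < η by linarith) (show η < 1 by linarith)
  refine ⟨min 1 (η / C), lt_min one_pos (div_pos (by linarith) hC), ?_⟩
  have hpoly := H.eventually_exp_le hr (show 0 < (1 - θ) / 2 by linarith) 2
  filter_upwards [hmom, hpoly, eventually_ge_atTop 2] with s hs hs2 hs3 E hE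
  have hs0 : 0 < s := by linarith
  have hη' : 0 < 1 - η := by linarith
  set l := (1 - η) * h s / s with hl
  have hl0 : 0 ≤ l := div_nonneg (mul_nonneg hη'.le (H.nonneg s)) hs0.le
  set f : ℝ≥0 → ℝ := fun x => if (x : ℝ) ≤ s then (x : ℝ) else 0 with hf
  have hfm : Measurable f := Measurable.ite
    (measurableSet_le measurable_coe_nnreal_real measurable_const)
    measurable_coe_nnreal_real measurable_const
  set Y : ι → Ω → ℝ := fun e ω => f (τ e ω) with hY
  have hYi : iIndepFun Y P := hi.comp (fun _ => f) fun _ => hfm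
  have hYm : ∀ e, Measurable (Y e) := fun e => hfm.comp (hm e)
  have hYint : ∀ e, Integrable (fun ω => Real.exp (l * Y e ω)) P := fun e =>
    (hs (τ e) (hm e) (htail e)).1
  have hcard : (E.card : ℝ) ≤ s := hE.trans (by
    have := min_le_left 1 (η / C)
    nlinarith)
  have hcard2 : C * E.card ≤ η * s := by
    have h1 := mul_le_mul_of_nonneg_right (min_le_right 1 (η / C)) hs0.le
    have h2 := mul_le_mul_of_nonneg_left (hE.trans h1) hC.le
    have h3 : C * (η / C * s) = η * s := by field_simp
    linarith
  have hsum : P.real {ω | s ≤ ∑ e ∈ E, Y e ω} ≤ Real.exp (-((1 + θ) / 2 * h s)) := by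
    have h1 := measure_ge_le_exp_mul_mgf (μ := P) (X := ∑ e ∈ E, Y e) s hl0
      (hYi.integrable_exp_mul_sum hYm fun e _ => hYint e)
    rw [hYi.mgf_sum hYm] at h1
    simp only [Finset.sum_apply] at h1
    refine h1.trans ?_
    have h2 : ∏ e ∈ E, mgf (Y e) P l ≤ Real.exp (l * C * E.card) := by
      calc ∏ e ∈ E, mgf (Y e) P l ≤ ∏ _e ∈ E, Real.exp (l * C) := by
            refine Finset.prod_le_prod (fun e _ => mgf_nonneg) fun e _ => ?_
            have := (hs (τ e) (hm e) (htail e)).2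
            refine le_trans this ?_
            linarith [Real.add_one_le_exp (l * C)]
        _ = _ := by rw [Finset.prod_const, ← Real.exp_nat_mul]; ring_nf
    refine (mul_le_mul_of_nonneg_left h2 (Real.exp_pos _).le).trans ?_
    rw [← Real.exp_add]
    refine Real.exp_le_exp.2 ?_
    have h3 : l * s = (1 - η) * h s := by rw [hl]; field_simp
    have h4 : l * (C * E.card) ≤ l * (η * s) := mul_le_mul_of_nonneg_left hcard2 hl0
    have h5 : l * (η * s) = η * ((1 - η) * h s) := by rw [← h3]; ring
    have h6 : (1 + θ) / 2 * h s ≤ (1 - η) * ((1 - η) * h s) := by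
      rw [← mul_assoc]
      refine mul_le_mul_of_nonneg_right ?_ (H.nonneg s)
      nlinarith [sq_nonneg η]
    nlinarith
  have hmax : P.real {ω | ∃ e ∈ E, s < (τ e ω : ℝ)} ≤ s * Real.exp (-((1 + θ) / 2 * h s)) := by
    have h1 : {ω | ∃ e ∈ E, s < (τ e ω : ℝ)} = ⋃ e ∈ E, {ω | s < (τ e ω : ℝ)} := by
      ext ω; simp
    rw [h1]
    refine (measureReal_biUnion_finset_le _ _).trans ?_
    simp only [htail, Finset.sum_const, nsmul_eq_mul]
    refine mul_le_mul hcard (Real.exp_le_exp.2 ?_) (Real.exp_pos _).le hs0.le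
    have := H.nonneg s
    nlinarith
  -- Either a single weight exceeds `s`, or truncation at `s` changes nothing. The spare `(1 - θ) /
  -- 2 * h s` then absorbs the factor `1 + s ≤ s ^ 2`.
  have hsub : {ω | s ≤ ∑ e ∈ E, (τ e ω : ℝ)} ⊆
      {ω | s ≤ ∑ e ∈ E, Y e ω} ∪ {ω | ∃ e ∈ E, s < (τ e ω : ℝ)} := by
    intro ω hω
    by_cases hc : ∃ e ∈ E, s < (τ e ω : ℝ)
    · exact Or.inr hc
    · push Not at hc
      left
      have h1 : ∑ e ∈ E, Y e ω = ∑ e ∈ E, (τ e ω : ℝ) :=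
        Finset.sum_congr rfl fun e he => by simp [hY, hf, hc e he]
      change s ≤ ∑ e ∈ E, Y e ω
      rw [h1]
      exact hω
  calc P.real {ω | s ≤ ∑ e ∈ E, (τ e ω : ℝ)}
      ≤ _ := measureReal_mono hsub
    _ ≤ _ := measureReal_union_le _ _
    _ ≤ Real.exp (-((1 + θ) / 2 * h s)) + s * Real.exp (-((1 + θ) / 2 * h s)) :=
      add_le_add hsum hmax
    _ = (1 + s) * Real.exp (-((1 - θ) / 2 * h s)) * Real.exp (-(θ * h s)) := by
      rw [mul_assoc, ← Real.exp_add]; ring_nf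
    _ ≤ 1 * Real.exp (-(θ * h s)) := by
      refine mul_le_mul_of_nonneg_right ?_ (Real.exp_pos _).le
      refine (mul_le_mul_of_nonneg_left hs2 (by linarith)).trans ?_
      rw [Real.rpow_neg hs0.le, ← div_eq_mul_inv, div_le_one (by positivity)]
      rw [show (2 : ℝ) = ((2 : ℕ) : ℝ) by norm_num, Real.rpow_natCast]
      nlinarith
    _ = _ := one_mul _

/-- The big jump estimate at level `s = α n`, rewritten with `h(α n) ~ α^r h(n)`. For `α = 0` the
bound is at least 1; this case is needed when one endpoint carries none of the delay. -/
lemma eventually_sum_tail_le (H : RegularTail h r) (hr : 0 < r) (hr1 : r < 1)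
    (hm : ∀ e, Measurable (τ e)) (hi : iIndepFun τ P)
    (htail : ∀ e t, P.real {ω | t < (τ e ω : ℝ)} = Real.exp (-h t)) {α δ : ℝ} (hα : 0 ≤ α)
    (hδ : 0 < δ) :
    ∀ᶠ ε : ℝ in 𝓝[>] 0, ∀ᶠ n : ℕ in atTop, ∀ E : Finset ι, (E.card : ℝ) ≤ ε * n →
      P.real {ω | α * n ≤ ∑ e ∈ E, (τ e ω : ℝ)} ≤ Real.exp (-((α ^ r - δ) * h n)) := by
  have := hi.isProbabilityMeasure
  rcases hα.eq_or_lt with rfl | hα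
  · refine Eventually.of_forall fun ε => Eventually.of_forall fun n E _ => ?_
    refine measureReal_le_one.trans (Real.one_le_exp ?_)
    rw [Real.zero_rpow hr.ne']
    have := mul_nonneg hδ.le (H.nonneg n)
    linarith
  have hαr : 0 < α ^ r := by positivity
  obtain ⟨θ, hθ0, hθ1, hθ⟩ : ∃ θ : ℝ, 0 < θ ∧ θ < 1 ∧ α ^ r - δ < θ * α ^ r := by
    rcases le_or_gt (α ^ r) δ with hle | hlt
    · exact ⟨1 / 2, by norm_num, by norm_num, by linarith⟩
    · refine ⟨1 - δ / (2 * α ^ r), ?_, ?_, ?_⟩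
      · rw [sub_pos, div_lt_one (by positivity)]; linarith
      · have : 0 < δ / (2 * α ^ r) := by positivity
        linarith
      · rw [sub_mul, div_mul_eq_mul_div, one_mul]
        have : δ * α ^ r / (2 * α ^ r) = δ / 2 := by field_simp
        linarith
  obtain ⟨ε₀, hε₀, hs⟩ := exists_sum_tail_le H hr hr1 hm hi htail hθ0 hθ1
  have hlim := (((H.tendsto_ratio α hα).const_mul θ).comp tendsto_natCast_atTop_atTop).eventually
    (lt_mem_nhds hθ)
  filter_upwards [Ioo_mem_nhdsGT (show 0 < ε₀ * α by positivity)] with ε hε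
  have h1 : Tendsto (fun n : ℕ => α * (n : ℝ)) atTop atTop :=
    tendsto_natCast_atTop_atTop.const_mul_atTop hα
  filter_upwards [h1.eventually hs, hlim,
    ((H.tendsto_atTop hr).comp tendsto_natCast_atTop_atTop).eventually_gt_atTop 0]
    with n hn hn2 hn3 E hE
  refine (hn E (hE.trans ?_)).trans (Real.exp_le_exp.2 (neg_le_neg ?_))
  · rw [← mul_assoc]
    exact mul_le_mul_of_nonneg_right hε.2.le (Nat.cast_nonneg _)
  · simp only [Function.comp_apply] at hn2 hn3
    rw [← mul_div_assoc, lt_div_iff₀ hn3] at hn2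
    exact hn2.le

end BigJump

/-! ### The time constant and a second moment lower bound. -/

variable {P : Measure Ω} {τ : Edge d → Ω → ℝ≥0}

lemma floorPt_zero : floorPt (0 : Fin d → ℝ) = 0 := by
  ext i; simp [floorPt]

lemma meanPassageTime_eq (P : Measure Ω) (τ : Edge d → Ω → ℝ≥0) (x : Fin d → ℝ) :
    meanPassageTime P τ x = meanTime P τ 0 (floorPt x) := by
  simp only [meanPassageTime, meanTime, passageTime_eq, floorPt_zero]
  rfl

lemma abs_floor_sub_floor_le (a b : ℝ) : (|⌊a⌋ - ⌊b⌋| : ℝ) ≤ |a - b| + 1 := by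
  have h1 := Int.floor_le a
  have h2 := Int.lt_floor_add_one a
  have h3 := Int.floor_le b
  have h4 := Int.lt_floor_add_one b
  rw [abs_le]
  constructor
  · linarith [neg_abs_le (a - b)]
  · linarith [le_abs_self (a - b)]

lemma sum_abs_floorPt_sub_le (x y : Fin d → ℝ) :
    ((∑ i, |floorPt x i - floorPt y i| : ℤ) : ℝ) ≤ ∑ i, (|x i - y i| + 1) := by
  push_cast
  exact Finset.sum_le_sum fun i _ => abs_floor_sub_floor_le _ _

lemma measurable_killOrigin : Measurable (killOrigin : (Edge d → ℝ≥0) → Edge d → ℝ≥0) := by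
  refine measurable_pi_lambda _ fun e => ?_
  by_cases he : e ∈ Set.range (originEdge : Fin d × Bool → Edge d)
  · simp only [killOrigin, he, if_true]
    exact measurable_const
  · simp only [killOrigin, he, if_false]
    exact measurable_pi_apply e

namespace IIDWeights

lemma meanTime_eq_sub (h : IIDWeights P τ) (u v : Fin d → ℤ) :
    meanTime P τ u v = meanTime P τ 0 (v - u) := by
  have := h.meanTime_add 0 (v - u) u
  simpa using this

lemma meanTime_le_add (h : IIDWeights P τ) {C : ℝ}
    (hC : ∀ u v : Fin d → ℤ, meanTime P τ u v ≤ C * (∑ i, |u i - v i| : ℤ)) (u v z : Fin d → ℤ) :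
    meanTime P τ u v ≤ meanTime P τ 0 z + C * (∑ i, |z i - (v i - u i)| : ℤ) := by
  rw [h.meanTime_eq_sub u v]
  refine (h.meanTime_triangle 0 z (v - u)).trans ?_
  have := hC z (v - u)
  simp only [Pi.sub_apply] at this
  linarith

/-- The time constant exists as a limit along the reals. -/
theorem tendsto_timeConstant (h : IIDWeights P τ) (x : Fin d → ℝ) :
    Tendsto (fun t : ℝ => t⁻¹ * meanPassageTime P τ (t • x)) atTop (𝓝 (timeConstant P τ x)) := by
  obtain ⟨C, hC0, hC, -⟩ := h.exists_moment_bound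
  set a : ℝ → ℝ := fun t => meanPassageTime P τ (t • x) with ha
  have ha_eq : ∀ t, a t = meanTime P τ 0 (floorPt (t • x)) := fun t => meanPassageTime_eq _ _ _
  have ha0 : ∀ t, 0 ≤ a t := fun t => by rw [ha_eq]; exact meanTime_nonneg _ _ _ _
  have hsub : ∀ s t, a (s + t) ≤ a s + (a t + C * d) := by
    intro s t
    rw [ha_eq, ha_eq, ha_eq]
    refine (h.meanTime_triangle 0 (floorPt (s • x)) _).trans (add_le_add_right ?_ _)
    refine (h.meanTime_le_add hC _ _ (floorPt (t • x))).trans (add_le_add_right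
      (mul_le_mul_of_nonneg_left ?_ hC0) _)
    have h1 : ∑ i, |floorPt (t • x) i - (floorPt ((s + t) • x) i - floorPt (s • x) i)| ≤
        ∑ _i : Fin d, (1 : ℤ) := by
      refine Finset.sum_le_sum fun i _ => ?_
      simp only [floorPt, Pi.smul_apply, smul_eq_mul, add_mul]
      have h2 := Int.le_floor_add (s * x i) (t * x i)
      have h3 := Int.le_floor_add_floor (s * x i) (t * x i)
      rw [abs_le]
      constructor <;> linarith
    have h2 : ∑ _i : Fin d, (1 : ℤ) = d := by simp
    rw [h2] at h1
    exact_mod_cast h1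
  -- Integer parts are additive up to 1 in each coordinate, so adding the constant `C * d` restores
  -- exact subadditivity for Fekete's lemma.
  have hsubadd : Subadditive fun n : ℕ => a n + C * d := by
    intro m n
    have := hsub m n
    push_cast
    linarith
  have hCd : 0 ≤ C * d := by positivity
  have hlim := hsubadd.tendsto_lim ⟨0, by
    rintro _ ⟨n, rfl⟩
    exact div_nonneg (add_nonneg (ha0 _) hCd) (Nat.cast_nonneg _)⟩
  set L := hsubadd.lim
  have hlim2 : Tendsto (fun n : ℕ => a n / n) atTop (𝓝 L) := by
    have h1 : Tendsto (fun n : ℕ => C * d / (n : ℝ)) atTop (𝓝 0) :=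
      tendsto_const_div_atTop_nhds_zero_nat _
    have h2 := hlim.sub h1
    rw [sub_zero] at h2
    refine h2.congr fun n => ?_
    rw [← sub_div, add_sub_cancel_right]
  have hosc : ∀ t : ℝ, 0 ≤ t → |a t - a ⌊t⌋₊| ≤ C * ∑ i, (|x i| + 1) := by
    intro t ht
    have hb : ∀ s s' : ℝ, |s - s'| ≤ 1 → a s - a s' ≤ C * ∑ i, (|x i| + 1) := by
      intro s s' hs
      rw [ha_eq, ha_eq]
      have h1 := h.meanTime_triangle 0 (floorPt (s' • x)) (floorPt (s • x))
      have h2 := hC (floorPt (s' • x)) (floorPt (s • x))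
      have h3 := sum_abs_floorPt_sub_le (s' • x) (s • x)
      have h4 : ∑ i, (|(s' • x) i - (s • x) i| + 1) ≤ ∑ i, (|x i| + 1) := by
        refine Finset.sum_le_sum fun i _ => add_le_add_left ?_ _
        simp only [Pi.smul_apply, smul_eq_mul, ← sub_mul, abs_mul]
        rw [abs_sub_comm] at hs
        exact mul_le_of_le_one_left (abs_nonneg _) hs
      have h5 := mul_le_mul_of_nonneg_left (h3.trans h4) hC0
      linarith
    have h1 : |t - ⌊t⌋₊| ≤ 1 := by
      rw [abs_le]
      constructor <;> linarith [Nat.floor_le ht, Nat.lt_floor_add_one t]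
    rw [abs_le]
    have h2 := hb _ _ h1
    rw [abs_sub_comm] at h1
    have h3 := hb _ _ h1
    constructor <;> linarith
  have hmain : Tendsto (fun t : ℝ => t⁻¹ * a t) atTop (𝓝 L) := by
    have h1 : Tendsto (fun t : ℝ => (a t - a ⌊t⌋₊) / t) atTop (𝓝 0) := by
      have h2 : Tendsto (fun t : ℝ => C * ∑ i, (|x i| + 1) / t) atTop (𝓝 (C * 0)) := by
        refine Tendsto.const_mul _ ?_
        rw [← Finset.sum_const_zero (s := (Finset.univ : Finset (Fin d)))]
        exact tendsto_finsetSum _ fun i _ => tendsto_const_nhds.div_atTop tendsto_id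
      rw [mul_zero] at h2
      refine squeeze_zero_norm' ?_ h2
      filter_upwards [eventually_gt_atTop 0] with t ht
      rw [Real.norm_eq_abs, abs_div, abs_of_pos ht, ← Finset.sum_div, ← mul_div_assoc]
      exact div_le_div_of_nonneg_right (hosc t ht.le) ht.le
    have h2 := (hlim2.comp (tendsto_nat_floor_atTop (α := ℝ))).mul (tendsto_nat_floor_div_atTop (R := ℝ))
    have h3 := h1.add h2
    simp only [mul_one, zero_add] at h3
    refine h3.congr' ?_
    filter_upwards [eventually_ge_atTop 1] with t ht
    have h4 : (⌊t⌋₊ : ℝ) ≠ 0 := by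
      have := Nat.floor_pos.2 ht
      positivity
    simp only [Function.comp_apply]
    rw [div_mul_div_cancel₀ h4, ← add_div]
    rw [sub_add_cancel, div_eq_inv_mul]
  exact tendsto_nhds_limUnder ⟨L, hmain⟩

lemma timeConstant_nonneg (h : IIDWeights P τ) (x : Fin d → ℝ) : 0 ≤ timeConstant P τ x := by
  refine ge_of_tendsto (h.tendsto_timeConstant x) ?_
  filter_upwards [eventually_ge_atTop 0] with t ht
  rw [meanPassageTime_eq]
  exact mul_nonneg (inv_nonneg.2 ht) (meanTime_nonneg _ _ _ _)

/-- With probability bounded below, the passage time to `n x` is at least `n (μ(x) - ε)`, even if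
the edges at the origin may be used for free. -/
lemma exists_prob_killOrigin_ge (h : IIDWeights P τ) (x : Fin d → ℝ) {ε : ℝ} (hε : 0 < ε) :
    ∃ c > 0, ∀ᶠ n : ℕ in atTop, c ≤ P.real {ω | n * (timeConstant P τ x - ε) ≤
      (latticeTime (killOrigin (config τ ω)) 0 (floorPt ((n : ℝ) • x)) : ℝ)} := by
  have := h.isProbabilityMeasure
  obtain ⟨C, hC0, -, hC⟩ := h.exists_moment_bound
  set μ := timeConstant P τ x
  rcases le_or_gt (μ - ε) 0 with hneg | hpos
  · refine ⟨1, one_pos, Eventually.of_forall fun n => ?_⟩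
    have : {ω | n * (μ - ε) ≤
      (latticeTime (killOrigin (config τ ω)) 0 (floorPt ((n : ℝ) • x)) : ℝ)} = Set.univ := by
      ext ω
      simp only [Set.mem_univ, iff_true]
      exact (mul_nonpos_of_nonneg_of_nonpos (Nat.cast_nonneg n) hneg).trans (NNReal.coe_nonneg _)
    rw [this]
    simp
  set K := ∑ i, (|x i| + 1) with hK
  have hK0 : 0 ≤ K := Finset.sum_nonneg fun i _ => by positivity
  set Q := C * K ^ 2 + 1 with hQ
  have hQ0 : 0 < Q := by positivity
  set D := ∑ k, ∫ ω, (τ (originEdge k) ω : ℝ) ∂P with hD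
  refine ⟨ε ^ 2 / (8 * Q), by positivity, ?_⟩
  have hlim := (h.tendsto_timeConstant x).comp (tendsto_natCast_atTop_atTop (R := ℝ))
  have hDlim : Tendsto (fun n : ℕ => D / (n : ℝ)) atTop (𝓝 0) :=
    tendsto_const_div_atTop_nhds_zero_nat _
  filter_upwards [hlim.eventually (lt_mem_nhds (show μ - ε / 4 < μ by linarith)),
    hDlim.eventually (gt_mem_nhds (show 0 < ε / 4 by linarith)), eventually_ge_atTop 1]
    with n hn1 hn2 hn3
  have hn0 : (0 : ℝ) < n := by exact_mod_cast hn3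
  have hn1' : (1 : ℝ) ≤ n := by exact_mod_cast hn3
  set y := floorPt ((n : ℝ) • x) with hy
  simp only [Function.comp_apply, meanPassageTime_eq, ← hy] at hn1
  rw [← div_eq_inv_mul, lt_div_iff₀ hn0] at hn1
  rw [div_lt_iff₀ hn0] at hn2
  set Z : Ω → ℝ := fun ω => (latticeTime (killOrigin (config τ ω)) 0 y : ℝ) with hZ
  set T : Ω → ℝ := fun ω => (latticeTime (config τ ω) 0 y : ℝ) with hT
  have hZm : Measurable Z := ((FPP.measurable_latticeTime 0 y).comp
    (measurable_killOrigin.comp h.measurable_config)).coe_nnreal_real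
  have hZ0 : ∀ ω, 0 ≤ Z ω := fun ω => NNReal.coe_nonneg _
  have hZT : ∀ ω, Z ω ≤ T ω := fun ω => by
    simp only [hZ, hT, NNReal.coe_le_coe]
    refine le_latticeTime fun γ => ?_
    exact (latticeTime_le_pathTime _ γ).trans (pathTime_mono (killOrigin_le _) γ)
  have hTZ : ∀ ω, T ω ≤ Z ω + ∑ k, (τ (originEdge k) ω : ℝ) := fun ω => by
    have := latticeTime_le_killOrigin_add (config τ ω) 0 y
    rw [← NNReal.coe_le_coe] at this
    simpa [config] using this
  have hTL := h.memLp_latticeTime 0 y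
  have hZL : MemLp Z 2 P := hTL.mono hZm.aestronglyMeasurable (Eventually.of_forall fun ω => by
    rw [Real.norm_eq_abs, abs_of_nonneg (hZ0 ω)]
    exact (hZT ω).trans (le_abs_self _))
  have hZi : Integrable Z P := hZL.integrable (by norm_num)
  have hmean : n * (μ - ε / 2) ≤ ∫ ω, Z ω ∂P := by
    have h1 : ∫ ω, T ω ∂P ≤ ∫ ω, Z ω ∂P + D := by
      rw [hD, ← integral_finsetSum _ fun k _ => h.integrable _,
        ← integral_add hZi (integrable_finsetSum _ fun k _ => h.integrable _)]
      exact integral_mono (h.integrable_latticeTime 0 y)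
        (hZi.add (integrable_finsetSum _ fun k _ => h.integrable _)) hTZ
    have h2 : meanTime P τ 0 y = ∫ ω, T ω ∂P := rfl
    linarith
  have hsq : ∫ ω, Z ω ^ 2 ∂P ≤ Q * n ^ 2 := by
    have h1 : ∫ ω, Z ω ^ 2 ∂P ≤ ∫ ω, T ω ^ 2 ∂P :=
      integral_mono hZL.integrable_sq hTL.integrable_sq fun ω =>
        pow_le_pow_left₀ (hZ0 ω) (hZT ω) 2
    have h2 : ((∑ i, |(0 : Fin d → ℤ) i - y i| : ℤ) : ℝ) ≤ K * n := by
      have h3 := sum_abs_floorPt_sub_le 0 ((n : ℝ) • x)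
      rw [floorPt_zero] at h3
      refine h3.trans ?_
      rw [hK, Finset.sum_mul]
      refine Finset.sum_le_sum fun i _ => ?_
      simp only [Pi.zero_apply, Pi.smul_apply, smul_eq_mul, zero_sub, abs_neg, abs_mul,
        abs_of_pos hn0]
      nlinarith [abs_nonneg (x i)]
    have h3 : 0 ≤ ((∑ i, |(0 : Fin d → ℤ) i - y i| : ℤ) : ℝ) := by
      exact_mod_cast Finset.sum_nonneg fun i _ => abs_nonneg _
    have h4 := mul_le_mul_of_nonneg_left (pow_le_pow_left₀ h3 h2 2) hC0
    have h5 := hC 0 y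
    have h6 : (0 : ℝ) ≤ (n : ℝ) ^ 2 := by positivity
    calc _ ≤ _ := h1
      _ ≤ _ := h5
      _ ≤ _ := h4
      _ ≤ Q * n ^ 2 := by rw [hQ]; nlinarith
  set B : Set Ω := {ω | n * (μ - ε) ≤ Z ω} with hB
  have hBm : MeasurableSet B := measurableSet_le measurable_const hZm
  -- Since the second moment is at most `Q n²`, this `s` makes the mean of `Z² / (4s)` at most `n ε
  -- / 4`. The mean of `Z` is at least `n (μ - ε / 2)`, so `n ε / 4` must come from the event `B`.
  set s := Q * n / ε with hs
  have hs0 : 0 < s := by positivity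
  -- On `B` this is the inequality `Z ≤ Z² / (4s) + s` of arithmetic and geometric means.
  have hpt : ∀ ω, Z ω ≤ n * (μ - ε) + (Z ω ^ 2 * (1 / (4 * s)) + B.indicator (fun _ => s) ω) := by
    intro ω
    by_cases hω : ω ∈ B
    · rw [Set.indicator_of_mem hω]
      have h1 : Z ω ≤ Z ω ^ 2 * (1 / (4 * s)) + s := by
        rw [mul_one_div, div_add' _ _ _ (by positivity), le_div_iff₀ (by positivity)]
        nlinarith [sq_nonneg (Z ω - 2 * s)]
      have : 0 ≤ n * (μ - ε) := by positivity
      linarith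
    · rw [Set.indicator_of_notMem hω]
      have h1 : Z ω < n * (μ - ε) := not_le.1 hω
      have : 0 ≤ Z ω ^ 2 * (1 / (4 * s)) := by positivity
      linarith
  have hint : ∫ ω, Z ω ∂P ≤ n * (μ - ε) + ((∫ ω, Z ω ^ 2 ∂P) * (1 / (4 * s)) + P.real B * s) := by
    have hi1 : Integrable (fun ω => Z ω ^ 2 * (1 / (4 * s))) P := hZL.integrable_sq.mul_const _
    have hi2 : Integrable (B.indicator fun _ => s) P := (integrable_const s).indicator hBm
    have hi3 : Integrable (fun ω => Z ω ^ 2 * (1 / (4 * s)) + B.indicator (fun _ => s) ω) P :=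
      hi1.add hi2
    calc _ ≤ ∫ ω, (n * (μ - ε) + (Z ω ^ 2 * (1 / (4 * s)) + B.indicator (fun _ => s) ω)) ∂P :=
          integral_mono hZi ((integrable_const _).add hi3) hpt
      _ = _ := by
        rw [integral_add (integrable_const _) hi3, integral_add hi1 hi2,
          integral_mul_const (1 / (4 * s)) fun ω => Z ω ^ 2, integral_indicator hBm]
        simp
  have h1 : (∫ ω, Z ω ^ 2 ∂P) * (1 / (4 * s)) ≤ n * ε / 4 := by
    refine (mul_le_mul_of_nonneg_right hsq (by positivity)).trans (le_of_eq ?_)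
    rw [hs]; field_simp
  have h2 : n * ε / 4 ≤ P.real B * s := by linarith
  rw [div_le_iff₀ (by positivity)]
  rw [hs, ← mul_div_assoc, le_div_iff₀ hε] at h2
  have h3 : n * (ε * ε) ≤ n * (4 * (P.real B * Q)) := by linarith
  have h4 := le_of_mul_le_mul_left h3 hn0
  have h5 : 0 ≤ P.real B * Q := by positivity
  nlinarith

end IIDWeights

/-! ### The lower bound. -/

variable {h : ℝ → ℝ} {r : ℝ}

lemma eventually_floorPt_ne_zero {x : Fin d → ℝ} (hx : x ≠ 0) :
    ∀ᶠ n : ℕ in atTop, floorPt ((n : ℝ) • x) ≠ 0 := by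
  obtain ⟨i, hi⟩ := Function.ne_iff.1 hx
  have hpos : 0 < |x i| := abs_pos.2 hi
  have h1 : Tendsto (fun n : ℕ => (n : ℝ) * |x i|) atTop atTop :=
    tendsto_natCast_atTop_atTop.atTop_mul_const hpos
  filter_upwards [h1.eventually_gt_atTop 1] with n hn h0
  have h2 := congrFun h0 i
  simp only [floorPt, Pi.smul_apply, smul_eq_mul, Pi.zero_apply, Int.floor_eq_zero_iff,
    Set.mem_Ico] at h2
  have h3 : (n : ℝ) * |x i| = |n * x i| := by rw [abs_mul, Nat.abs_cast]
  rw [h3, abs_of_nonneg h2.1] at hn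
  linarith

/-- Lower bound: all edges at the origin have a large weight. -/
theorem IIDWeights.eventually_exp_le_prob (hτ : IIDWeights P τ) (H : RegularTail h r) (hr : 0 < r)
    (htail : ∀ e t, P.real {ω | t < (τ e ω : ℝ)} = Real.exp (-h t)) {x : Fin d → ℝ} (hx : x ≠ 0)
    {ξ : ℝ} (hξ : 0 < ξ) {δ : ℝ} (hδ : 0 < δ) :
    ∀ᶠ n : ℕ in atTop, Real.exp (-((2 * d * ξ ^ r + δ) * h n)) ≤
      P.real {ω | n * (timeConstant P τ x + ξ) <
        (latticeTime (config τ ω) 0 (floorPt ((n : ℝ) • x)) : ℝ)} := by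
  have := hτ.isProbabilityMeasure
  set μ := timeConstant P τ x
  obtain ⟨ε, hε0, hε⟩ : ∃ ε : ℝ, 0 < ε ∧ 2 * d * (ξ + 2 * ε) ^ r < 2 * d * ξ ^ r + δ / 2 := by
    have hc : ContinuousAt (fun ε : ℝ => 2 * d * (ξ + 2 * ε) ^ r) 0 := by
      refine ContinuousAt.mul continuousAt_const (ContinuousAt.rpow_const (by fun_prop) ?_)
      left; simpa using hξ.ne'
    have h1 := hc.eventually (gt_mem_nhds (show 2 * d * (ξ + 2 * 0) ^ r <
      2 * d * ξ ^ r + δ / 2 by simpa using hδ))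
    have h2 := (h1.filter_mono nhdsWithin_le_nhds).and (self_mem_nhdsWithin (s := Set.Ioi (0 : ℝ)))
    obtain ⟨ε, h3, h4⟩ := h2.exists
    exact ⟨ε, h4, h3⟩
  obtain ⟨c, hc0, hc⟩ := hτ.exists_prob_killOrigin_ge x hε0
  have hs0 : 0 < ξ + 2 * ε := by positivity
  have hlim := (((H.tendsto_ratio _ hs0).const_mul (2 * (d : ℝ))).comp
    tendsto_natCast_atTop_atTop).eventually (gt_mem_nhds hε)
  have hh := (H.tendsto_atTop hr).comp (tendsto_natCast_atTop_atTop (R := ℝ))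
  filter_upwards [hc, hlim, hh.eventually_gt_atTop 0,
    (hh.const_mul_atTop (half_pos hδ)).eventually_ge_atTop (-Real.log c),
    eventually_floorPt_ne_zero hx, eventually_gt_atTop 0] with n hn1 hn2 hn3 hn4 hn5 hn6
  simp only [Function.comp_apply] at hn2 hn3 hn4
  rw [← mul_div_assoc, div_lt_iff₀ hn3] at hn2
  have hn0 : (0 : ℝ) < n := by exact_mod_cast hn6
  set y := floorPt ((n : ℝ) • x)
  -- `none` stands for the event away from the origin edges, `some k` for one large origin edge.
  -- Together they force a passage time of at least `n (μ + ξ + ε)`, and the constant probability of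
  -- `none` is absorbed by `δ / 2 * h n`.
  set A : Option (Fin d × Bool) → Set (Edge d → ℝ≥0) := fun o => o.elim
    {w | n * (μ - ε) ≤ (latticeTime (killOrigin w) 0 y : ℝ)}
    fun k => {w | (ξ + 2 * ε) * n < (w (originEdge k) : ℝ)} with hA
  set S : Option (Fin d × Bool) → Set (Edge d) := fun o => o.elim
    (Set.range originEdge)ᶜ fun k => {originEdge k} with hS
  have hprod := measureReal_iInter_config hτ.measurable hτ.indep Finset.univ S A
    (by
      rintro (_ | k) -
      · exact measurableSet_le measurable_const ((FPP.measurable_latticeTime 0 y).comp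
          measurable_killOrigin).coe_nnreal_real
      · exact measurableSet_lt measurable_const
          (measurable_pi_apply (originEdge k)).coe_nnreal_real)
    (by
      rintro (_ | k) - w w' hw
      · have : killOrigin w = killOrigin w' := by
          ext e
          by_cases he : e ∈ Set.range (originEdge : Fin d × Bool → Edge d)
          · simp only [killOrigin, he, if_true]
          · simp only [killOrigin, he, if_false]
            rw [hw e he]
        simp only [hA, Option.elim, Set.mem_ofPred_eq, this]
      · have := hw (originEdge k) rfl
        simp only [hA, Option.elim, Set.mem_ofPred_eq, this])
    (by
      rintro (_ | k) - (_ | l) - hkl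
      · exact absurd rfl hkl
      · exact Set.disjoint_singleton_right.2 fun hc => hc ⟨l, rfl⟩
      · exact Set.disjoint_singleton_left.2 fun hc => hc ⟨k, rfl⟩
      · refine Set.disjoint_singleton.2 fun hc => hkl ?_
        rw [originEdge_injective hc])
  rw [Fintype.prod_option] at hprod
  have e1 : ∀ k, P.real {ω | config τ ω ∈ A (some k)} = Real.exp (-h ((ξ + 2 * ε) * n)) :=
    fun k => htail _ _
  simp only [e1, Finset.prod_const, Finset.card_univ, Fintype.card_prod, Fintype.card_fin,
    Fintype.card_bool] at hprod
  have hsub : {ω | ∀ k ∈ Finset.univ, config τ ω ∈ A k} ⊆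
      {ω | n * (μ + ξ) < (latticeTime (config τ ω) 0 y : ℝ)} := by
    intro ω hω
    have h1 : n * (μ - ε) ≤ (latticeTime (killOrigin (config τ ω)) 0 y : ℝ) :=
      hω none (Finset.mem_univ _)
    have h2 : ∀ k, (ξ + 2 * ε) * n < (config τ ω (originEdge k) : ℝ) :=
      fun k => hω (some k) (Finset.mem_univ _)
    have h3 := add_killOrigin_le_latticeTime (w := config τ ω) hn5
      (a := ((ξ + 2 * ε) * n).toNNReal) fun k => by
        rw [Real.toNNReal_le_iff_le_coe]; exact (h2 k).le
    rw [← NNReal.coe_le_coe, NNReal.coe_add, Real.coe_toNNReal _ (by positivity)] at h3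
    change n * (μ + ξ) < (latticeTime (config τ ω) 0 y : ℝ)
    nlinarith
  calc Real.exp (-((2 * d * ξ ^ r + δ) * h n))
      ≤ Real.exp (Real.log c + (d * 2 : ℕ) * -h ((ξ + 2 * ε) * n)) := by
        refine Real.exp_le_exp.2 ?_
        push_cast
        linarith
    _ = c * Real.exp (-h ((ξ + 2 * ε) * n)) ^ (d * 2) := by
        rw [Real.exp_add, Real.exp_log hc0, Real.exp_nat_mul]
    _ ≤ _ := mul_le_mul_of_nonneg_right hn1 (by positivity)
    _ = P.real {ω | ∀ k ∈ Finset.univ, config τ ω ∈ A k} := hprod.symm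
    _ ≤ _ := measureReal_mono hsub

/-! ### Edge-disjoint connections near an endpoint. -/

section Petals

/-- Edge-disjoint connections from `0` to `R eⱼ`, one for each of the `2d` edges at the origin;
the one leaving in direction `-eⱼ` makes a detour in direction `eₗ`. -/
noncomputable def petal (j l : Fin d) (R : ℕ) : Fin d × Bool → Finset (Edge d)
  | (i, true) => open Classical in
    if i = j then lineEdges 0 j R
    else {latEdge 0 i} ∪ lineEdges (Pi.single i 1) j R ∪ {latEdge (Pi.single j (R : ℤ)) i}
  | (i, false) => open Classical in
    if i = j then
      {latEdge (-Pi.single j 1) j} ∪ lineEdges (-Pi.single j 1) l 2 ∪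
        lineEdges (-Pi.single j 1 + Pi.single l 2) j (R + 2) ∪
        lineEdges (Pi.single j (R + 1 : ℤ)) l 2 ∪ {latEdge (Pi.single j (R : ℤ)) j}
    else {latEdge (-Pi.single i 1) i} ∪ lineEdges (-Pi.single i 1) j R ∪
      {latEdge (-Pi.single i 1 + Pi.single j (R : ℤ)) i}

/-- A description of the edges `{p, p + e_q}` of `petal j l R k`. -/
def PetalSpec (j l : Fin d) (R : ℤ) : Fin d × Bool → (Fin d → ℤ) → Fin d → Prop
  | (i, true), p, q =>
    (i = j ∧ q = j ∧ (∀ m, m ≠ j → p m = 0) ∧ 0 ≤ p j ∧ p j < R) ∨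
    (i ≠ j ∧ q = j ∧ p i = 1 ∧ ∀ m, m ≠ j → m ≠ i → p m = 0) ∨
    (i ≠ j ∧ q = i ∧ (∀ m, m ≠ j → p m = 0) ∧ (p j = 0 ∨ p j = R))
  | (i, false), p, q =>
    (i = j ∧ q = j ∧ (∀ m, m ≠ j → p m = 0) ∧ (p j = -1 ∨ p j = R)) ∨
    (i = j ∧ q = j ∧ p l = 2 ∧ ∀ m, m ≠ j → m ≠ l → p m = 0) ∨
    (i = j ∧ q = l ∧ (p j = -1 ∨ p j = R + 1) ∧ 0 ≤ p l ∧ p l ≤ 1 ∧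
      ∀ m, m ≠ j → m ≠ l → p m = 0) ∨
    (i ≠ j ∧ q = j ∧ p i = -1 ∧ ∀ m, m ≠ j → m ≠ i → p m = 0) ∨
    (i ≠ j ∧ q = i ∧ p i = -1 ∧ (p j = 0 ∨ p j = R) ∧ ∀ m, m ≠ j → m ≠ i → p m = 0)

lemma petal_spec {j l : Fin d} (hjl : j ≠ l) {R : ℕ} {k : Fin d × Bool} {e : Edge d}
    (he : e ∈ petal j l R k) : ∃ p q, e = latEdge p q ∧ PetalSpec j l R k p q := by
  obtain ⟨i, _ | _⟩ := k
  · by_cases hij : i = j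
    · subst hij
      simp only [petal, if_true, Finset.mem_union, Finset.mem_singleton, mem_lineEdges] at he
      rcases he with (((rfl | ⟨t, ht, rfl⟩) | ⟨t, ht, rfl⟩) | ⟨t, ht, rfl⟩) | rfl
      · refine ⟨_, _, rfl, Or.inl ⟨rfl, rfl, fun m hm => ?_, Or.inl ?_⟩⟩ <;> simp [*]
      · refine ⟨_, _, rfl, Or.inr (Or.inr (Or.inl ⟨rfl, rfl, Or.inl ?_, ?_, ?_, fun m hm hm' => ?_⟩))⟩ <;>
          simp [*, hjl.symm]
        omega
      · refine ⟨_, _, rfl, Or.inr (Or.inl ⟨rfl, rfl, ?_, fun m hm hm' => ?_⟩)⟩ <;>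
          simp [*, hjl.symm]
      · refine ⟨_, _, rfl, Or.inr (Or.inr (Or.inl ⟨rfl, rfl, Or.inr ?_, ?_, ?_, fun m hm hm' => ?_⟩))⟩ <;>
          simp [*, hjl.symm]
        omega
      · refine ⟨_, _, rfl, Or.inl ⟨rfl, rfl, fun m hm => ?_, Or.inr ?_⟩⟩ <;> simp [*]
    · have hji : j ≠ i := Ne.symm hij
      simp only [petal, hij, if_false, Finset.mem_union, Finset.mem_singleton, mem_lineEdges] at he
      rcases he with (rfl | ⟨t, ht, rfl⟩) | rfl
      · refine ⟨_, _, rfl, Or.inr (Or.inr (Or.inr (Or.inr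
          ⟨hij, rfl, ?_, Or.inl ?_, fun m hm hm' => ?_⟩)))⟩ <;> simp [*]
      · refine ⟨_, _, rfl, Or.inr (Or.inr (Or.inr (Or.inl
          ⟨hij, rfl, ?_, fun m hm hm' => ?_⟩)))⟩ <;> simp [*]
      · refine ⟨_, _, rfl, Or.inr (Or.inr (Or.inr (Or.inr
          ⟨hij, rfl, ?_, Or.inr ?_, fun m hm hm' => ?_⟩)))⟩ <;> simp [*]
  · by_cases hij : i = j
    · subst hij
      simp only [petal, if_true, mem_lineEdges] at he
      obtain ⟨t, ht, rfl⟩ := he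
      refine ⟨_, _, rfl, Or.inl ⟨rfl, rfl, fun m hm => ?_, ?_, ?_⟩⟩ <;> simp [*]
    · have hji : j ≠ i := Ne.symm hij
      simp only [petal, hij, if_false, Finset.mem_union, Finset.mem_singleton, mem_lineEdges] at he
      rcases he with (rfl | ⟨t, ht, rfl⟩) | rfl
      · refine ⟨_, _, rfl, Or.inr (Or.inr ⟨hij, rfl, fun m hm => ?_, Or.inl ?_⟩)⟩ <;> simp
      · refine ⟨_, _, rfl, Or.inr (Or.inl ⟨hij, rfl, ?_, fun m hm hm' => ?_⟩)⟩ <;> simp [*]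
      · refine ⟨_, _, rfl, Or.inr (Or.inr ⟨hij, rfl, fun m hm => ?_, Or.inr ?_⟩)⟩ <;> simp [*]

/-- The base point and direction of an edge determine its petal. The detour of the petal leaving
along `-eⱼ` runs at height 2 over `[-1, R + 1]` because height 1 in direction `eₗ` is taken by the
petal of `(l, true)`. -/
lemma PetalSpec.eq {j l : Fin d} (hjl : j ≠ l) {R : ℤ} (hR : 1 ≤ R) {k k' : Fin d × Bool}
    {p : Fin d → ℤ} {q : Fin d} (h : PetalSpec j l R k p q) (h' : PetalSpec j l R k' p q) :
    k = k' := by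
  obtain ⟨i, _ | _⟩ := k <;> obtain ⟨i', _ | _⟩ := k' <;> simp only [PetalSpec] at h h'
  · have : i = i' := by grind
    rw [this]
  · exfalso; grind
  · exfalso; grind
  · have : i = i' := by grind
    rw [this]

/-- All petals stay in a slab of bounded width across `eₗ`, so a translation by more than 4 in that
direction makes them disjoint from the original ones. -/
lemma PetalSpec.abs_le {j l : Fin d} (hjl : j ≠ l) {R : ℤ} {k : Fin d × Bool}
    {p : Fin d → ℤ} {q : Fin d} (h : PetalSpec j l R k p q) : |p l| ≤ 2 := by
  rw [_root_.abs_le]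
  obtain ⟨i, _ | _⟩ := k <;> simp only [PetalSpec] at h <;> grind

lemma disjoint_petal {j l : Fin d} (hjl : j ≠ l) {R : ℕ} (hR : 1 ≤ R) {k k' : Fin d × Bool}
    (hk : k ≠ k') : Disjoint (petal j l R k) (petal j l R k') := by
  rw [Finset.disjoint_left]
  intro e he he'
  obtain ⟨p, q, rfl, h⟩ := petal_spec hjl he
  obtain ⟨p', q', h2, h'⟩ := petal_spec hjl he'
  obtain ⟨rfl, rfl⟩ := latEdge_inj.1 h2
  exact hk (h.eq hjl (by exact_mod_cast hR) h')

lemma disjoint_petal_shift {j l : Fin d} (hjl : j ≠ l) {R : ℕ} {k k' : Fin d × Bool}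
    {a : Fin d → ℤ} (ha : 4 < |a l|) :
    Disjoint (petal j l R k) ((petal j l R k').map (shift a).toEmbedding) := by
  rw [Finset.disjoint_left]
  intro e he he'
  obtain ⟨e', he₂, rfl⟩ := Finset.mem_map.1 he'
  obtain ⟨p, q, h1, h⟩ := petal_spec hjl he
  obtain ⟨p', q', rfl, h'⟩ := petal_spec hjl he₂
  change shift a (latEdge p' q') = _ at h1
  rw [shift_latEdge] at h1
  obtain ⟨rfl, rfl⟩ := latEdge_inj.1 h1
  have h2 := h.abs_le hjl
  have h3 := h'.abs_le hjl
  simp only [Pi.add_apply] at h2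
  rw [abs_le] at h2 h3
  rcases lt_abs.1 ha with h4 | h4 <;> omega

lemma card_petal_le (j l : Fin d) (R : ℕ) (k : Fin d × Bool) :
    (petal j l R k).card ≤ R + 8 := by
  classical
  have hline := fun p i R => card_lineEdges_le (d := d) p i R
  obtain ⟨i, _ | _⟩ := k <;> simp only [petal] <;> split_ifs
  · refine (Finset.card_union_le _ _).trans ((add_le_add_left ((Finset.card_union_le _ _).trans
      (add_le_add_left ((Finset.card_union_le _ _).trans (add_le_add_left
      (Finset.card_union_le _ _) _)) _)) _).trans ?_)
    have h1 := hline (-Pi.single j 1) l 2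
    have h2 := hline (-Pi.single j 1 + Pi.single l 2) j (R + 2)
    have h3 := hline (Pi.single j (R + 1 : ℤ)) l 2
    simp only [Finset.card_singleton]
    omega
  · refine (Finset.card_union_le _ _).trans ((add_le_add_left (Finset.card_union_le _ _) _).trans ?_)
    have h1 := hline (-Pi.single i 1) j R
    simp only [Finset.card_singleton]
    omega
  · have h1 := hline 0 j R
    omega
  · refine (Finset.card_union_le _ _).trans ((add_le_add_left (Finset.card_union_le _ _) _).trans ?_)
    have h1 := hline (Pi.single i 1) j R
    simp only [Finset.card_singleton]
    omega

lemma connectedIn_petal (j l : Fin d) (R : ℕ) (k : Fin d × Bool) :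
    ConnectedIn (petal j l R k) 0 (Pi.single j (R : ℤ)) := by
  classical
  have hedge : ∀ {E : Finset (Edge d)} {p p' : Fin d → ℤ} {i : Fin d}, latEdge p i ∈ E →
      p' = p + Pi.single i 1 → ConnectedIn E p p' := fun h h' => h' ▸ ConnectedIn.of_latEdge h
  have hline : ∀ {E : Finset (Edge d)} {p p' : Fin d → ℤ} {i : Fin d} {R : ℕ},
      lineEdges p i R ⊆ E → p' = p + Pi.single i (R : ℤ) → ConnectedIn E p p' :=
    fun h h' => h' ▸ (ConnectedIn.of_lineEdges _ _ _).mono h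
  obtain ⟨i, _ | _⟩ := k
  · by_cases hij : i = j
    · subst hij
      refine (hedge (p := -Pi.single i 1) (i := i) ?_ ?_).symm.trans
        ((hline (i := l) (R := 2) (p' := -Pi.single i 1 + Pi.single l 2) ?_ ?_).trans
        ((hline (i := i) (R := R + 2) (p' := Pi.single i (R + 1 : ℤ) + Pi.single l 2) ?_ ?_).trans
        ((hline (p := Pi.single i (R + 1 : ℤ)) (i := l) (R := 2) ?_ ?_).symm.trans
        (hedge (i := i) ?_ ?_).symm)))
      · simp [petal]
      · simp
      · intro e he
        simp [petal, he]
      · simp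
      · intro e he
        simp [petal, he]
      · rw [add_assoc, add_comm (Pi.single l 2), ← add_assoc, ← Pi.single_neg, ← Pi.single_add]
        congr 2
        push_cast
        ring
      · intro e he
        simp [petal, he]
      · simp
      · simp [petal]
      · rw [← Pi.single_add]
    · refine (hedge (p := -Pi.single i 1) (i := i) ?_ ?_).symm.trans
        ((hline (i := j) (R := R) ?_ rfl).trans (hedge (i := i) ?_ ?_))
      · simp [petal, hij]
      · simp
      · intro e he
        simp [petal, hij, he]
      · simp [petal, hij]
      · rw [add_comm, ← add_assoc, add_neg_cancel, zero_add]
  · by_cases hij : i = j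
    · subst hij
      exact hline (i := i) (R := R) (by simp [petal]) (by simp)
    · refine (hedge (p' := Pi.single i 1) (i := i) ?_ ?_).trans
        ((hline (i := j) (R := R) ?_ rfl).trans (hedge (i := i) ?_ ?_).symm)
      · simp [petal, hij]
      · simp
      · intro e he
        simp [petal, hij, he]
      · simp [petal, hij]
      · rw [add_comm]

end Petals

/-! ### The cost of slow connections at both endpoints. -/

section Connection

lemma exists_lt_mul_sub_rpow {b ξ r δ : ℝ} (hξ : 0 < ξ) (hδ : 0 < δ) :
    ∃ ε : ℝ, 0 < ε ∧ ε < ξ ∧ b * ξ ^ r - δ < b * (ξ - ε) ^ r := by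
  have hc : ContinuousAt (fun ε : ℝ => b * (ξ - ε) ^ r) 0 := by
    refine ContinuousAt.mul continuousAt_const (ContinuousAt.rpow_const (by fun_prop) ?_)
    left; simpa using hξ.ne'
  have h1 := hc.eventually (lt_mem_nhds (show b * ξ ^ r - δ < b * (ξ - 0) ^ r by
    rw [sub_zero]; linarith))
  have h2 := (h1.filter_mono nhdsWithin_le_nhds).and (Ioo_mem_nhdsGT hξ)
  obtain ⟨ε, h3, h4⟩ := h2.exists
  exact ⟨ε, h4.1, h4.2, h3⟩

/-- If two groups of `2d` short sums over disjoint sets of edges are such that the minima of the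
groups add up to `ξ n`, then `2d` large weights are needed, of total cost `2d ξ ^ r h(n)`. -/
lemma IIDWeights.eventually_prob_two_minima_le (hτ : IIDWeights P τ) (H : RegularTail h r)
    (hr : 0 < r) (hr1 : r < 1)
    (htail : ∀ e t, P.real {ω | t < (τ e ω : ℝ)} = Real.exp (-h t)) {ξ : ℝ} (hξ : 0 < ξ)
    {δ : ℝ} (hδ : 0 < δ) :
    ∀ᶠ ε : ℝ in 𝓝[>] 0, ∀ᶠ n : ℕ in atTop,
      ∀ F : (Fin d × Bool) ⊕ (Fin d × Bool) → Finset (Edge d),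
        (∀ k, ((F k).card : ℝ) ≤ ε * n) → (Pairwise fun k k' => Disjoint (F k) (F k')) →
        P.real {ω | ∀ k k', ξ * n ≤ ∑ e ∈ F (.inl k), (τ e ω : ℝ) + ∑ e ∈ F (.inr k'), (τ e ω : ℝ)} ≤
          Real.exp (-((2 * d * ξ ^ r - δ) * h n)) := by
  have := hτ.isProbabilityMeasure
  obtain ⟨ρ₀, hρ₀, hρξ, hρ⟩ : ∃ ρ₀ : ℝ, 0 < ρ₀ ∧ ρ₀ < ξ ∧
      2 * d * ξ ^ r - δ / 4 < 2 * d * (ξ - ρ₀) ^ r :=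
    exists_lt_mul_sub_rpow hξ (by positivity)
  -- The range `[0, ξ n]` of the first minimum is cut into `K` cells of width `ρ n` with `ρ ≤ ρ₀`;
  -- rounding down loses at most one cell.
  obtain ⟨K₀, hK₀⟩ := exists_nat_gt (ξ / ρ₀)
  set K := K₀ + 1 with hK
  have hKpos : (0 : ℝ) < K := by rw [hK]; positivity
  set ρ := ξ / K with hρdef
  have hρ0 : 0 < ρ := div_pos hξ hKpos
  have hKρ : K * ρ = ξ := by rw [hρdef]; field_simp
  have hρle : ρ ≤ ρ₀ := by
    rw [hρdef, div_le_iff₀ hKpos]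
    rw [div_lt_iff₀ hρ₀] at hK₀
    rw [hK]; push_cast
    nlinarith
  set δ' := δ / (16 * (d + 1)) with hδ'
  have hδ'0 : 0 < δ' := by positivity
  have hev : ∀ᶠ ε : ℝ in 𝓝[>] 0, ∀ i ∈ Finset.range (K + 1), ∀ᶠ n : ℕ in atTop,
      ∀ E : Finset (Edge d), (E.card : ℝ) ≤ ε * n →
      P.real {ω | i * ρ * n ≤ ∑ e ∈ E, (τ e ω : ℝ)} ≤ Real.exp (-(((i * ρ) ^ r - δ') * h n)) := by
    rw [eventually_all_finset]
    intro i _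
    exact eventually_sum_tail_le H hr hr1 hτ.measurable hτ.indep htail (by positivity) hδ'0
  filter_upwards [hev] with ε hε
  rw [← eventually_all_finset] at hε
  have hh := (H.tendsto_atTop hr).comp (tendsto_natCast_atTop_atTop (R := ℝ))
  filter_upwards [hε, hh.eventually_ge_atTop (Real.log (K + 1) / (δ / 2)), eventually_gt_atTop 0]
    with n hn hn2 hn3 F hcard hdisj
  have hn0 : (0 : ℝ) < n := by exact_mod_cast hn3
  simp only [Function.comp_apply] at hn2
  rw [div_le_iff₀ (by positivity)] at hn2
  set A : ℕ → (Fin d × Bool) ⊕ (Fin d × Bool) → Set (Edge d → ℝ≥0) := fun i k =>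
    {w | ((k.elim (fun _ => i) fun _ => K - 1 - i : ℕ) : ℝ) * ρ * n ≤ ∑ e ∈ F k, (w e : ℝ)} with hA
  have hprob : ∀ i ∈ Finset.range (K + 1),
      P.real {ω | ∀ k ∈ Finset.univ, config τ ω ∈ A i k} ≤
        Real.exp (-((2 * d * ξ ^ r - δ / 2) * h n)) := by
    intro i hi
    have hiK : i ≤ K := Nat.lt_succ_iff.1 (Finset.mem_range.1 hi)
    rw [measureReal_iInter_config hτ.measurable hτ.indep Finset.univ (fun k => (F k : Set (Edge d)))
      (A i) (fun k _ => measurableSet_le measurable_const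
        (Finset.measurable_fun_sum _ fun e _ => (measurable_pi_apply e).coe_nnreal_real))
      (fun k _ w w' hw => by
        simp only [hA, Set.mem_ofPred_eq]
        rw [Finset.sum_congr rfl fun e he => by rw [hw e he]])
      (fun k _ k' _ hkk' => by exact_mod_cast hdisj hkk')]
    have hK1 : K - 1 - i ∈ Finset.range (K + 1) := Finset.mem_range.2 (by omega)
    calc ∏ k, P.real {ω | config τ ω ∈ A i k}
        ≤ ∏ k : (Fin d × Bool) ⊕ (Fin d × Bool), k.elim
            (fun _ => Real.exp (-(((i * ρ) ^ r - δ') * h n)))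
            fun _ => Real.exp (-(((((K - 1 - i : ℕ) : ℝ) * ρ) ^ r - δ') * h n)) := by
          refine Finset.prod_le_prod (fun _ _ => measureReal_nonneg) ?_
          rintro (k | k) -
          · exact hn i hi _ (hcard _)
          · exact hn _ hK1 _ (hcard _)
      _ = Real.exp (-(2 * d * ((i * ρ) ^ r + (((K - 1 - i : ℕ) : ℝ) * ρ) ^ r - 2 * δ') * h n)) := by
          rw [Fintype.prod_sum_type]
          simp only [Sum.elim_inl, Sum.elim_inr, Finset.prod_const, Finset.card_univ,
            Fintype.card_prod, Fintype.card_fin, Fintype.card_bool]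
          rw [← Real.exp_nat_mul, ← Real.exp_nat_mul, ← Real.exp_add]
          congr 1
          push_cast
          ring
      _ ≤ _ := by
          refine Real.exp_le_exp.2 (neg_le_neg (mul_le_mul_of_nonneg_right ?_ (H.nonneg _)))
          -- Subadditivity of `t ↦ t^r`: sharing the delay between the endpoints is no cheaper than
          -- concentrating it.
          have h1 := Real.rpow_add_le_add_rpow (p := r) (show 0 ≤ i * ρ by positivity)
            (show 0 ≤ ((K - 1 - i : ℕ) : ℝ) * ρ by positivity) hr.le hr1.le
          have h2 : ξ - ρ₀ ≤ i * ρ + ((K - 1 - i : ℕ) : ℝ) * ρ := by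
            have h3 : (K : ℝ) - 1 ≤ i + ((K - 1 - i : ℕ) : ℝ) := by
              have : K ≤ i + (K - 1 - i) + 1 := by omega
              have : (K : ℝ) ≤ i + ((K - 1 - i : ℕ) : ℝ) + 1 := by exact_mod_cast this
              linarith
            nlinarith
          have h3 := (Real.rpow_le_rpow (by linarith) h2 hr.le).trans h1
          have h5 := mul_le_mul_of_nonneg_left h3 (show (0 : ℝ) ≤ 2 * d by positivity)
          have h6 : 2 * (d : ℝ) * (2 * δ') ≤ δ / 4 := by
            have : 2 * (d : ℝ) * (2 * δ') = δ / 4 * (d / (d + 1)) := by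
              rw [hδ']; field_simp; ring
            rw [this]
            refine mul_le_of_le_one_right (by positivity) ?_
            rw [div_le_one (by positivity)]
            linarith
          linarith
  have hsub : {ω | ∀ k k', ξ * n ≤ ∑ e ∈ F (.inl k), (τ e ω : ℝ) + ∑ e ∈ F (.inr k'), (τ e ω : ℝ)} ⊆
      ⋃ i ∈ Finset.range (K + 1), {ω | ∀ k ∈ Finset.univ, config τ ω ∈ A i k} := by
    intro ω hω
    rw [Set.mem_iUnion₂]
    set s : Fin d × Bool → ℝ := fun k => ∑ e ∈ F (.inl k), (τ e ω : ℝ) with hs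
    have hs0 : ∀ k, 0 ≤ s k := fun k => Finset.sum_nonneg fun _ _ => NNReal.coe_nonneg _
    by_cases hall : ∀ k, K * ρ * n ≤ s k
    -- If the first group alone accounts for `ξ n`, the truncated difference `K - 1 - K = 0` imposes
    -- nothing on the second.
    · refine ⟨K, Finset.mem_range.2 (by omega), ?_⟩
      rintro (k | k) -
      · exact hall k
      · have : K - 1 - K = 0 := by omega
        simp only [hA, Set.mem_ofPred_eq, Sum.elim_inr, this, Nat.cast_zero, zero_mul]
        exact Finset.sum_nonneg fun _ _ => NNReal.coe_nonneg _
    · push Not at hall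
      obtain ⟨k₀, hk₀⟩ := hall
      have : Nonempty (Fin d × Bool) := ⟨k₀⟩
      obtain ⟨k₁, hk₁⟩ := Finite.exists_min s
      have hρn : 0 < ρ * n := by positivity
      have hsk : s k₁ < K * (ρ * n) := by rw [← mul_assoc]; exact (hk₁ k₀).trans_lt hk₀
      set i := ⌊s k₁ / (ρ * n)⌋₊ with hi
      have h1 : i * (ρ * n) ≤ s k₁ := by
        rw [← le_div_iff₀ hρn]; exact Nat.floor_le (div_nonneg (hs0 _) hρn.le)
      have h2 : s k₁ < (i + 1) * (ρ * n) := by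
        rw [← div_lt_iff₀ hρn]; exact Nat.lt_floor_add_one _
      have hiK : i < K := by
        have := h1.trans_lt hsk
        exact_mod_cast lt_of_mul_lt_mul_right this hρn.le
      refine ⟨i, Finset.mem_range.2 (by omega), ?_⟩
      rintro (k | k) -
      · have := h1.trans (hk₁ k)
        rw [← mul_assoc] at this
        exact this
      · have h3 : ξ * n ≤ s k₁ + ∑ e ∈ F (.inr k), (τ e ω : ℝ) := hω k₁ k
        have h4 : ((K - 1 - i : ℕ) : ℝ) = K - 1 - i := by
          rw [Nat.sub_sub, Nat.cast_sub (by omega)]; push_cast; ring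
        change ((K - 1 - i : ℕ) : ℝ) * ρ * n ≤ ∑ e ∈ F (.inr k), (τ e ω : ℝ)
        rw [h4]
        rw [← hKρ] at h3
        linarith
  calc _ ≤ _ := measureReal_mono hsub (measure_ne_top _ _)
    _ ≤ _ := measureReal_biUnion_finset_le _ _
    _ ≤ ∑ i ∈ Finset.range (K + 1), Real.exp (-((2 * d * ξ ^ r - δ / 2) * h n)) :=
      Finset.sum_le_sum hprob
    _ = (K + 1) * Real.exp (-((2 * d * ξ ^ r - δ / 2) * h n)) := by simp
    _ = Real.exp (Real.log (K + 1) + -((2 * d * ξ ^ r - δ / 2) * h n)) := by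
      rw [Real.exp_add, Real.exp_log (by positivity)]
    _ ≤ _ := Real.exp_le_exp.2 (by linarith)

/-- The endpoints of the tube at distance `R` are reached in total time `ξ n` with high
probability. -/
lemma IIDWeights.eventually_prob_connection_le (hτ : IIDWeights P τ) (H : RegularTail h r)
    (hr : 0 < r) (hr1 : r < 1)
    (htail : ∀ e t, P.real {ω | t < (τ e ω : ℝ)} = Real.exp (-h t)) {j l : Fin d} (hjl : j ≠ l)
    {ξ : ℝ} (hξ : 0 < ξ) {δ : ℝ} (hδ : 0 < δ) :
    ∀ᶠ ε : ℝ in 𝓝[>] 0, ∀ᶠ n : ℕ in atTop, ∀ (R : ℕ) (y : Fin d → ℤ), 1 ≤ R →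
      (R + 8 : ℝ) ≤ ε * n → 4 < |y l| →
        P.real {ω | ξ * n ≤ (latticeTime (config τ ω) 0 (Pi.single j (R : ℤ)) : ℝ) +
          latticeTime (config τ ω) y (y + Pi.single j (R : ℤ))} ≤
          Real.exp (-((2 * d * ξ ^ r - δ) * h n)) := by
  have := hτ.isProbabilityMeasure
  filter_upwards [hτ.eventually_prob_two_minima_le H hr hr1 htail hξ hδ] with ε hε
  filter_upwards [hε] with n hn R y hR hRn hy
  refine le_trans (measureReal_mono fun ω hω => ?_) (hn (Sum.elim (petal j l R)
    fun k => (petal j l R k).map (shift y).toEmbedding) ?_ ?_)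
  · intro k k'
    refine le_trans hω (add_le_add ?_ ?_)
    · have := (connectedIn_petal j l R k).latticeTime_le (config τ ω)
      rw [← NNReal.coe_le_coe, NNReal.coe_sum] at this
      exact this
    · have := (connectedIn_petal j l R k').latticeTime_le (config τ ω ∘ shift y)
      rw [latticeTime_shift, zero_add, add_comm _ y, ← NNReal.coe_le_coe, NNReal.coe_sum] at this
      simpa [config] using this
  · rintro (k | k)
    · refine le_trans ?_ hRn
      exact_mod_cast card_petal_le j l R k
    · refine le_trans ?_ hRn
      simp only [Sum.elim_inr, Finset.card_map]
      exact_mod_cast card_petal_le j l R k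
  · rintro (k | k) (k' | k') hkk'
    · exact disjoint_petal hjl hR fun hc => hkk' (by rw [hc])
    · exact disjoint_petal_shift hjl hy
    · exact (disjoint_petal_shift hjl hy).symm
    · simp only [Sum.elim_inr]
      rw [Finset.disjoint_map]
      exact disjoint_petal hjl hR fun hc => hkk' (by rw [hc])

end Connection

/-! ### Disjoint tubes between translated endpoints. -/

section Tubes

lemma exists_eq_latEdge (e : Edge d) : ∃ p i, e = latEdge p i := by
  obtain ⟨e, he⟩ := e
  revert he
  refine Sym2.ind (fun u v => ?_) e
  intro huv
  obtain ⟨i, hi | hi⟩ := lattice_adj_cases huv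
  · obtain rfl : v = u + Pi.single i 1 := hi
    exact ⟨u, i, rfl⟩
  · obtain rfl : u = v + Pi.single i 1 := hi
    exact ⟨v, i, Subtype.ext Sym2.eq_swap⟩

lemma exists_abs_le_of_finset (U : Finset (Edge d)) :
    ∃ L : ℤ, ∀ p i, latEdge p i ∈ U → ∀ c, |p c| ≤ L := by
  classical
  induction U using Finset.induction_on with
  | empty => exact ⟨0, by simp⟩
  | insert e U _ ih =>
    obtain ⟨L, hL⟩ := ih
    obtain ⟨p₀, i₀, rfl⟩ := exists_eq_latEdge e
    refine ⟨max L (∑ c, |p₀ c|), fun p i hp c => ?_⟩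
    rcases Finset.mem_insert.1 hp with hp | hp
    · obtain ⟨rfl, rfl⟩ := latEdge_inj.1 hp
      exact le_max_of_le_right
        (Finset.single_le_sum (f := fun c => |p c|) (fun _ _ => abs_nonneg _) (Finset.mem_univ c))
    · exact le_max_of_le_left (hL p i hp c)

lemma abs_floor_add_sub_le (a b : ℝ) : |⌊b⌋ - (⌊a + b⌋ - ⌊a⌋)| ≤ 1 := by
  have h2 := Int.le_floor_add a b
  have h3 := Int.le_floor_add_floor a b
  rw [abs_le]
  constructor <;> linarith

/-- There are linearly many disjoint tubes along which the passage time is at most `n (μ(x) + ε)`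
with probability bounded below: the probability that `N` of them fail is exponentially small. -/
lemma IIDWeights.exists_prob_tubes_le (hτ : IIDWeights P τ) {x : Fin d → ℝ} {j l : Fin d}
    (hjl : j ≠ l) (hxl : x l ≠ 0) {ε : ℝ} (hε : 0 < ε) :
    ∃ M : ℕ, 1 ≤ M ∧ ∃ q : ℝ, 0 < q ∧ q < 1 ∧ ∀ᶠ n : ℕ in atTop, ∀ N : ℕ,
      P.real {ω | ∀ k ∈ Finset.Icc 1 N, n * (timeConstant P τ x + ε) ≤
        (latticeTime (config τ ω) (Pi.single j ((k * M : ℕ) : ℤ))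
          (floorPt ((n : ℝ) • x) + Pi.single j ((k * M : ℕ) : ℤ)) : ℝ)} ≤ q ^ N := by
  classical
  have := hτ.isProbabilityMeasure
  obtain ⟨C, hC0, hC, -⟩ := hτ.exists_moment_bound
  set μ := timeConstant P τ x with hμ
  have hμ0 : 0 ≤ μ := hτ.timeConstant_nonneg x
  set a : ℝ → ℝ := fun t => meanTime P τ 0 (floorPt (t • x)) with ha
  have hconst : Tendsto (fun t : ℝ => (C * d + 1) / t) atTop (𝓝 0) :=
    tendsto_const_nhds.div_atTop tendsto_id
  obtain ⟨t₁, ht₁⟩ := eventually_atTop.1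
    ((((hτ.tendsto_timeConstant x).eventually (gt_mem_nhds (show μ < μ + ε / 4 by linarith)))).and
    (hconst.eventually (gt_mem_nhds (show 0 < ε / 4 by linarith))))
  set t₀ := max t₁ 1 with ht₀def
  have ht₀ : 1 ≤ t₀ := le_max_right _ _
  -- Steps of length `t ≥ t₀` are long enough to absorb the rounding error `C * d` and the loss 1 of
  -- the local approximation.
  have hat : ∀ t, t₀ ≤ t → a t + (C * d + 1) ≤ t * (μ + ε / 2) := by
    intro t ht
    obtain ⟨h1, h2⟩ := ht₁ t ((le_max_left _ _).trans ht)
    have ht0 : 0 < t := by linarith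
    rw [meanPassageTime_eq, ← div_eq_inv_mul, div_lt_iff₀ ht0] at h1
    rw [div_lt_iff₀ ht0] at h2
    simp only [ha]
    linarith
  choose A g hgm hdep hle hint hmean using fun z : Fin d → ℤ => hτ.exists_local_approx 0 z
  set B : Finset (Fin d → ℤ) :=
    Finset.Icc (fun i => -⌈2 * t₀ * |x i| + 1⌉) (fun i => ⌈2 * t₀ * |x i| + 1⌉) with hB
  obtain ⟨L, hL⟩ := exists_abs_le_of_finset (B.biUnion A)
  have hxl0 : 0 < |x l| := abs_pos.2 hxl
  set D : ℝ := (2 * |(L : ℝ)| + 1) / |x l| with hD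
  have hD0 : 0 ≤ D := by positivity
  -- If two tubes share an edge, its `l`-coordinate fixes the position along `x` up to `D`, since `x
  -- l ≠ 0`. Their offsets along `eⱼ` then differ by at most this bound, so a spacing `M` beyond it
  -- makes the tubes disjoint.
  obtain ⟨M, hM⟩ := exists_nat_gt (2 * |(L : ℝ)| + 1 + D * |x j|)
  have hM1 : 1 ≤ M := by
    by_contra hc
    have h0 : M = 0 := by omega
    rw [h0, Nat.cast_zero] at hM
    have : 0 ≤ 2 * |(L : ℝ)| + 1 + D * |x j| := by positivity
    linarith
  refine ⟨M, hM1, (μ + ε / 2) / (μ + ε), by positivity,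
    (div_lt_one (by positivity)).2 (by linarith), ?_⟩
  filter_upwards [eventually_ge_atTop ⌈t₀⌉₊] with n hn N
  have hnt : t₀ ≤ n := (Nat.le_ceil t₀).trans (by exact_mod_cast hn)
  have hn0 : (0 : ℝ) < n := by linarith
  -- Divide the segment to `n x` into `J` equal steps of length between `t₀` and `2 t₀`. The lattice
  -- increments then lie in the fixed finite box `B`, so that finitely many local approximations,
  -- and one bound `L`, serve all `n`.
  set J := ⌊(n : ℝ) / t₀⌋₊ with hJ
  have hJ1 : 1 ≤ J := Nat.floor_pos.2 ((one_le_div (by linarith)).2 hnt)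
  have hJ0 : (0 : ℝ) < J := by exact_mod_cast hJ1
  set t : ℝ := n / J with ht
  have hJt : J * t = n := by rw [ht]; field_simp
  have htlo : t₀ ≤ t := by
    rw [ht, le_div_iff₀ hJ0, mul_comm, ← le_div_iff₀ (by linarith)]
    exact Nat.floor_le (by positivity)
  have hthi : t ≤ 2 * t₀ := by
    rw [ht, div_le_iff₀ hJ0]
    have h1 := Nat.lt_floor_add_one ((n : ℝ) / t₀)
    rw [div_lt_iff₀ (by linarith)] at h1
    have h2 : (1 : ℝ) ≤ J := by exact_mod_cast hJ1
    nlinarith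
  have ht0 : 0 < t := by linarith
  set c : ℕ → Fin d → ℤ := fun i => floorPt ((i * t : ℝ) • x) with hc
  have hc0 : c 0 = 0 := by simp [hc, floorPt_zero]
  have hcJ : c J = floorPt ((n : ℝ) • x) := by simp [hc, hJt]
  set z : ℕ → Fin d → ℤ := fun i => c (i + 1) - c i with hz
  have hzdiff : ∀ i m, |floorPt (t • x) m - z i m| ≤ 1 := by
    intro i m
    simp only [hz, hc, floorPt, Pi.sub_apply, Pi.smul_apply, smul_eq_mul]
    have := abs_floor_add_sub_le (i * t * x m) (t * x m)
    rwa [show i * t * x m + t * x m = ((i + 1 : ℕ) : ℝ) * t * x m by push_cast; ring] at this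
  have hzB : ∀ i, z i ∈ B := by
    intro i
    have hb : ∀ m, |z i m| ≤ ⌈2 * t₀ * |x m| + 1⌉ := by
      intro m
      have h1 : (|z i m| : ℝ) ≤ 2 * t₀ * |x m| + 1 := by
        have h2 := abs_floor_sub_floor_le (((i + 1 : ℕ) : ℝ) * t * x m) (i * t * x m)
        have h3 : |((i + 1 : ℕ) : ℝ) * t * x m - i * t * x m| = t * |x m| := by
          rw [← abs_of_pos ht0, ← abs_mul, abs_of_pos ht0]
          congr 1; push_cast; ring
        rw [h3] at h2
        have h4 : t * |x m| ≤ 2 * t₀ * |x m| := mul_le_mul_of_nonneg_right hthi (abs_nonneg _)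
        simp only [hz, hc, floorPt, Pi.sub_apply, Pi.smul_apply, smul_eq_mul, Int.cast_sub]
        linarith
      have h5 := h1.trans (Int.le_ceil _)
      exact_mod_cast h5
    rw [hB, Finset.mem_Icc]
    exact ⟨fun m => (abs_le.1 (hb m)).1, fun m => (abs_le.1 (hb m)).2⟩
  set u : ℕ → Fin d → ℤ := fun k => Pi.single j ((k * M : ℕ) : ℤ) with hu
  set X : ℕ → (Edge d → ℝ≥0) → ℝ := fun k w =>
    ∑ i ∈ Finset.range J, (g (z i) (w ∘ shift (c i + u k)) : ℝ) with hX
  have hshift : ∀ b : Fin d → ℤ, Measurable fun w : Edge d → ℝ≥0 => w ∘ shift b := fun b =>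
    measurable_pi_lambda _ fun e => measurable_pi_apply _
  have hXm : ∀ k, Measurable (X k) := fun k =>
    Finset.measurable_fun_sum _ fun i _ => ((hgm _).comp (hshift _)).coe_nnreal_real
  have hXi : ∀ k, ∀ i ∈ Finset.range J,
      Integrable (fun ω => (g (z i) (config τ ω ∘ shift (c i + u k)) : ℝ)) P := fun k i _ =>
    hτ.integrable_comp_shift (c i + u k) (g := fun w => (g (z i) w : ℝ))
      (hgm _).coe_nnreal_real (hint _)
  have hXmean : ∀ k, ∫ ω, X k (config τ ω) ∂P ≤ n * (μ + ε / 2) := by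
    intro k
    simp only [hX]
    rw [integral_finsetSum _ (hXi k)]
    calc ∑ i ∈ Finset.range J, ∫ ω, (g (z i) (config τ ω ∘ shift (c i + u k)) : ℝ) ∂P
        ≤ ∑ _i ∈ Finset.range J, (a t + (C * d + 1)) := by
          refine Finset.sum_le_sum fun i _ => ?_
          rw [hτ.integral_comp_shift (c i + u k) (g := fun w => (g (z i) w : ℝ))
            (hgm _).coe_nnreal_real]
          refine (hmean (z i)).trans ?_
          have h1 := hτ.meanTime_le_add hC 0 (z i) (floorPt (t • x))
          have h2 : ∑ m, |floorPt (t • x) m - (z i m - (0 : Fin d → ℤ) m)| ≤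
              ∑ _m : Fin d, (1 : ℤ) :=
            Finset.sum_le_sum fun m _ => by
              simpa only [Pi.zero_apply, sub_zero] using hzdiff i m
          have h3 : ∑ _m : Fin d, (1 : ℤ) = d := by simp
          rw [h3] at h2
          have h4 : ((∑ m, |floorPt (t • x) m - (z i m - (0 : Fin d → ℤ) m)| : ℤ) : ℝ) ≤ d := by
            exact_mod_cast h2
          have h5 := mul_le_mul_of_nonneg_left h4 hC0
          simp only [ha]
          linarith
      _ = J * (a t + (C * d + 1)) := by
          rw [Finset.sum_const, Finset.card_range, nsmul_eq_mul]
      _ ≤ J * (t * (μ + ε / 2)) := mul_le_mul_of_nonneg_left (hat t htlo) hJ0.le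
      _ = n * (μ + ε / 2) := by rw [← mul_assoc, hJt]
  have hXlat : ∀ k w, (latticeTime w (u k) (c J + u k) : ℝ) ≤ X k w := by
    intro k w
    have hstep : ∀ m, latticeTime w (u k) (c m + u k) ≤
        ∑ i ∈ Finset.range m, g (z i) (w ∘ shift (c i + u k)) := by
      intro m
      induction m with
      | zero => rw [hc0, zero_add, latticeTime_self]; exact zero_le
      | succ m ih =>
        rw [Finset.sum_range_succ]
        refine (latticeTime_triangle w _ (c m + u k) _).trans (add_le_add ih ?_)
        refine le_trans (le_of_eq ?_) (hle (z m) _)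
        rw [latticeTime_shift, zero_add, hz]
        congr 1
        funext s
        simp only [Pi.add_apply, Pi.sub_apply]
        ring
    have := hstep J
    rw [← NNReal.coe_le_coe, NNReal.coe_sum] at this
    exact this
  set S : ℕ → Set (Edge d) := fun k =>
    {e | ∃ i < J, ∃ e' ∈ A (z i), shift (c i + u k) e' = e} with hS
  have hSdisj : ∀ k k', k ≠ k' → Disjoint (S k) (S k') := by
    intro k k' hkk'
    rw [Set.disjoint_left]
    rintro e ⟨i, -, e₁, he₁, rfl⟩ ⟨i', -, e₂, he₂, heq⟩
    obtain ⟨p, s, rfl⟩ := exists_eq_latEdge e₁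
    obtain ⟨p', s', rfl⟩ := exists_eq_latEdge e₂
    rw [shift_latEdge, shift_latEdge] at heq
    have hp := (latEdge_inj.1 heq).1
    have hpL := hL p s (Finset.mem_biUnion.2 ⟨_, hzB i, he₁⟩)
    have hpL' := hL p' s' (Finset.mem_biUnion.2 ⟨_, hzB i', he₂⟩)
    have hLr : ∀ m, |(p m : ℝ)| ≤ |(L : ℝ)| ∧ |(p' m : ℝ)| ≤ |(L : ℝ)| := fun m =>
      ⟨by exact_mod_cast (hpL m).trans (le_abs_self _),
        by exact_mod_cast (hpL' m).trans (le_abs_self _)⟩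
    have hcl := congrFun hp l
    have hcj := congrFun hp j
    simp only [Pi.add_apply, hu, Pi.single_apply, if_true, hjl.symm, if_false, add_zero] at hcl hcj
    have hclr : (p' l : ℝ) + (c i' l : ℝ) = p l + c i l := by exact_mod_cast hcl
    have hcjr : (p' j : ℝ) + ((c i' j : ℝ) + (k' * M : ℝ)) = p j + ((c i j : ℝ) + (k * M : ℝ)) := by
      exact_mod_cast hcj
    have hcfl : ∀ i m, (c i m : ℝ) ≤ i * t * x m ∧ i * t * x m < c i m + 1 := fun i m =>
      ⟨Int.floor_le _, Int.lt_floor_add_one _⟩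
    have hdist : |(i : ℝ) * t - i' * t| ≤ D := by
      rw [hD, le_div_iff₀ hxl0, ← abs_mul, abs_le]
      have h1 := hcfl i l
      have h2 := hcfl i' l
      have h3 := abs_le.1 (hLr l).1
      have h4 := abs_le.1 (hLr l).2
      constructor <;> nlinarith
    have hdistj : |(c i j : ℝ) - c i' j| ≤ D * |x j| + 1 := by
      have h0 : |i * t * x j - i' * t * x j| ≤ D * |x j| := by
        rw [← sub_mul, abs_mul]
        exact mul_le_mul_of_nonneg_right hdist (abs_nonneg _)
      exact (abs_floor_sub_floor_le (i * t * x j) (i' * t * x j)).trans (by linarith)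
    have hkM : (M : ℝ) ≤ |((k : ℝ) - k') * M| := by
      rw [abs_mul, Nat.abs_cast]
      refine le_mul_of_one_le_left (Nat.cast_nonneg _) ?_
      have : (1 : ℤ) ≤ |(k : ℤ) - k'| := Int.one_le_abs (by omega)
      exact_mod_cast this
    have h3 := abs_le.1 (hLr j).1
    have h4 := abs_le.1 (hLr j).2
    have h5 := abs_le.1 hdistj
    have h6 : |((k : ℝ) - k') * M| ≤ 2 * |(L : ℝ)| + (D * |x j| + 1) := by
      rw [abs_le]
      constructor <;> linarith
    linarith
  have hprod := measureReal_iInter_config hτ.measurable hτ.indep (Finset.Icc 1 N) S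
    (fun k => {w | n * (μ + ε) ≤ X k w}) (fun k _ => measurableSet_le measurable_const (hXm k))
    (fun k _ w w' hw => by
      have : X k w = X k w' := by
        refine Finset.sum_congr rfl fun i hi => ?_
        rw [hdep (z i) fun e he => ?_]
        exact hw _ ⟨i, Finset.mem_range.1 hi, e, he, rfl⟩
      simp only [Set.mem_ofPred_eq, this])
    (fun k _ k' _ hkk' => hSdisj k k' hkk')
  refine (measureReal_mono (fun ω hω k hk => ?_) (measure_ne_top _ _)).trans
    (hprod.le.trans ?_)
  · have h1 := hω k hk
    rw [← hcJ] at h1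
    exact h1.trans (hXlat k _)
  -- Markov's inequality for one tube, whose mean is at most `n (μ + ε / 2)`.
  · have hone : ∀ k ∈ Finset.Icc 1 N, P.real {ω | config τ ω ∈ {w | n * (μ + ε) ≤ X k w}} ≤
        (μ + ε / 2) / (μ + ε) := by
      intro k _
      have hX0 : ∀ w, 0 ≤ X k w := fun w => Finset.sum_nonneg fun _ _ => NNReal.coe_nonneg _
      have h1 := mul_meas_ge_le_integral_of_nonneg (μ := P) (f := fun ω => X k (config τ ω))
        (Eventually.of_forall fun ω => hX0 _) (integrable_finsetSum _ (hXi k)) (n * (μ + ε))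
      rw [le_div_iff₀ (by positivity)]
      have h2 := h1.trans (hXmean k)
      have h3 : n * (P.real {ω | n * (μ + ε) ≤ X k (config τ ω)} * (μ + ε)) ≤
          n * (μ + ε / 2) := by linarith
      exact le_of_mul_le_mul_left h3 hn0
    refine (Finset.prod_le_prod (fun _ _ => measureReal_nonneg) hone).trans ?_
    rw [Finset.prod_const, Nat.card_Icc, Nat.add_sub_cancel]

end Tubes

/-! ### The upper bound. -/

section Main

/-- Upper bound: off an event of exponentially small probability, a late arrival is caused by the
weights near one of the endpoints. -/
theorem IIDWeights.eventually_prob_le_exp (hτ : IIDWeights P τ) (H : RegularTail h r) (hr : 0 < r)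
    (hr1 : r < 1) (htail : ∀ e t, P.real {ω | t < (τ e ω : ℝ)} = Real.exp (-h t)) (hd : 2 ≤ d)
    {x : Fin d → ℝ} (hx : x ≠ 0) {ξ : ℝ} (hξ : 0 < ξ) {δ : ℝ} (hδ : 0 < δ) :
    ∀ᶠ n : ℕ in atTop, P.real {ω | n * (timeConstant P τ x + ξ) <
        (latticeTime (config τ ω) 0 (floorPt ((n : ℝ) • x)) : ℝ)} ≤
      Real.exp (-((2 * d * ξ ^ r - δ) * h n)) := by
  have := hτ.isProbabilityMeasure
  set μ := timeConstant P τ x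
  obtain ⟨l, hl⟩ := Function.ne_iff.1 hx
  have hxl0 : 0 < |x l| := abs_pos.2 hl
  have : Nontrivial (Fin d) := Fin.nontrivial_iff_two_le.2 hd
  obtain ⟨j, hjl⟩ := exists_ne l
  obtain ⟨ε, hε0, hεξ, hε⟩ : ∃ ε : ℝ, 0 < ε ∧ ε < ξ ∧
      2 * d * ξ ^ r - δ / 4 < 2 * d * (ξ - ε) ^ r :=
    exists_lt_mul_sub_rpow hξ (by positivity)
  obtain ⟨M, hM1, q, hq0, hq1, htube⟩ := hτ.exists_prob_tubes_le hjl hl hε0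
  have hM0 : (0 : ℝ) < M := by exact_mod_cast hM1
  obtain ⟨η, hconn, hη0⟩ := ((hτ.eventually_prob_connection_le H hr hr1 htail hjl
    (sub_pos.2 hεξ) (show 0 < δ / 4 by positivity)).and self_mem_nhdsWithin).exists
  have hη : 0 < η := hη0
  have hlogq : 0 < -Real.log q := neg_pos.2 (Real.log_neg hq0 hq1)
  -- Once `h(n) / n` is below this constant, failure of all `N ≥ η n / (4M)` tubes is rarer than the
  -- target probability.
  have hκ : 0 < η / (4 * M) * -Real.log q / (2 * d * ξ ^ r + 1) := by positivity
  have hnat := tendsto_natCast_atTop_atTop (R := ℝ)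
  filter_upwards [htube, hconn, (H.tendsto_div.comp hnat).eventually (gt_mem_nhds hκ),
    hnat.eventually (H.eventually_exp_le hr (show 0 < δ / 2 by positivity) 2),
    eventually_gt_atTop 0, hnat.eventually_ge_atTop (16 / η), hnat.eventually_ge_atTop (4 * M / η),
    hnat.eventually_ge_atTop (1 + η), hnat.eventually_gt_atTop (5 / |x l|)]
    with n hn1 hn2 hn3 hn4 hn5 hn6 hn7 hn8 hn9
  have hn0 : (0 : ℝ) < n := by exact_mod_cast hn5
  set y := floorPt ((n : ℝ) • x) with hy
  -- For `k ≤ N` the offset `k M` is at most `η n / 2`; the other half of `η n` accommodates the 8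
  -- extra edges of a petal.
  set N := ⌊η * n / (2 * M)⌋₊ with hN
  rw [div_le_iff₀ hη] at hn6 hn7
  rw [div_lt_iff₀ hxl0] at hn9
  have hNle : (N : ℝ) * (2 * M) ≤ η * n := by
    rw [← le_div_iff₀ (by positivity)]
    exact Nat.floor_le (by positivity)
  have hNge : η * n ≤ (N : ℝ) * (4 * M) := by
    have h1 := Nat.lt_floor_add_one (η * n / (2 * M))
    rw [div_lt_iff₀ (by positivity)] at h1
    change η * n < ((N : ℝ) + 1) * (2 * M) at h1
    linarith
  have hyl : 4 < |y l| := by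
    have h1 : (n : ℝ) * |x l| = |n * x l| := by rw [abs_mul, Nat.abs_cast]
    have h2 := Int.floor_le (n * x l)
    have h3 := Int.lt_floor_add_one (n * x l)
    have h4 : (4 : ℝ) < |(⌊n * x l⌋ : ℝ)| := by
      rw [h1] at hn9
      rw [lt_abs] at hn9 ⊢
      rcases hn9 with h5 | h5
      · left; linarith
      · right; linarith
    exact_mod_cast h4
  have hfail : q ^ N ≤ Real.exp (-((2 * d * ξ ^ r - δ / 2) * h n)) := by
    rw [← Real.exp_log hq0, ← Real.exp_nat_mul]
    refine Real.exp_le_exp.2 ?_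
    simp only [Function.comp_apply] at hn3
    rw [div_lt_div_iff₀ hn0 (by positivity)] at hn3
    have h1 : η / (4 * M) * -Real.log q * n ≤ N * -Real.log q := by
      have h2 : η / (4 * M) * n ≤ N := by
        rw [div_mul_eq_mul_div, div_le_iff₀ (by positivity)]
        exact hNge
      have h3 := mul_le_mul_of_nonneg_right h2 hlogq.le
      linarith
    have h4 := H.nonneg n
    nlinarith
  have hone : ∀ k ∈ Finset.Icc 1 N,
      P.real {ω | (ξ - ε) * n ≤ (latticeTime (config τ ω) 0 (Pi.single j ((k * M : ℕ) : ℤ)) : ℝ) +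
        latticeTime (config τ ω) y (y + Pi.single j ((k * M : ℕ) : ℤ))} ≤
      Real.exp (-((2 * d * ξ ^ r - δ / 2) * h n)) := by
    intro k hk
    rw [Finset.mem_Icc] at hk
    refine (hn2 (k * M) y (Nat.mul_pos hk.1 hM1) ?_ hyl).trans
      (Real.exp_le_exp.2 (neg_le_neg (mul_le_mul_of_nonneg_right ?_ (H.nonneg _))))
    · have : (k : ℝ) ≤ N := by exact_mod_cast hk.2
      push_cast
      nlinarith
    · linarith
  have hsub : {ω | n * (μ + ξ) < (latticeTime (config τ ω) 0 y : ℝ)} ⊆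
      {ω | ∀ k ∈ Finset.Icc 1 N, n * (μ + ε) ≤
        (latticeTime (config τ ω) (Pi.single j ((k * M : ℕ) : ℤ))
          (y + Pi.single j ((k * M : ℕ) : ℤ)) : ℝ)} ∪
      ⋃ k ∈ Finset.Icc 1 N, {ω | (ξ - ε) * n ≤
        (latticeTime (config τ ω) 0 (Pi.single j ((k * M : ℕ) : ℤ)) : ℝ) +
        latticeTime (config τ ω) y (y + Pi.single j ((k * M : ℕ) : ℤ))} := by
    intro ω hω
    by_cases hall : ω ∈ {ω | ∀ k ∈ Finset.Icc 1 N, n * (μ + ε) ≤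
        (latticeTime (config τ ω) (Pi.single j ((k * M : ℕ) : ℤ))
          (y + Pi.single j ((k * M : ℕ) : ℤ)) : ℝ)}
    · exact Or.inl hall
    · right
      simp only [Set.mem_ofPred_eq] at hall
      push Not at hall
      obtain ⟨k, hk, hlt⟩ := hall
      refine Set.mem_iUnion₂.2 ⟨k, hk, ?_⟩
      set u : Fin d → ℤ := Pi.single j ((k * M : ℕ) : ℤ)
      -- Route through a tube that does not fail: it takes less than `n (μ + ε)`, so the two end
      -- connections account for the remaining `(ξ - ε) n`.
      have h1 := latticeTime_triangle (config τ ω) 0 u y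
      have h2 := latticeTime_triangle (config τ ω) u (y + u) y
      rw [latticeTime_comm _ (y + u) y] at h2
      have h3 := h1.trans (add_le_add_right h2 _)
      rw [← NNReal.coe_le_coe] at h3
      push_cast at h3
      have h4 : n * (μ + ξ) < (latticeTime (config τ ω) 0 y : ℝ) := hω
      change (ξ - ε) * n ≤ (latticeTime (config τ ω) 0 u : ℝ) + latticeTime (config τ ω) y (y + u)
      linarith
  have hN1 : 1 + (N : ℝ) ≤ (n : ℝ) ^ 2 := by
    have h1 : (N : ℝ) ≤ η * n := by
      have : (1 : ℝ) ≤ M := by exact_mod_cast hM1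
      nlinarith [N.cast_nonneg (α := ℝ)]
    have h2 : (1 : ℝ) ≤ n := by linarith
    nlinarith
  calc P.real {ω | n * (μ + ξ) < (latticeTime (config τ ω) 0 y : ℝ)}
      ≤ _ := measureReal_mono hsub (measure_ne_top _ _)
    _ ≤ _ := measureReal_union_le _ _
    _ ≤ Real.exp (-((2 * d * ξ ^ r - δ / 2) * h n)) +
        ∑ _k ∈ Finset.Icc 1 N, Real.exp (-((2 * d * ξ ^ r - δ / 2) * h n)) :=
      add_le_add ((hn1 N).trans hfail)
        ((measureReal_biUnion_finset_le _ _).trans (Finset.sum_le_sum hone))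
    _ = (1 + N) * Real.exp (-(δ / 2 * h n)) * Real.exp (-((2 * d * ξ ^ r - δ) * h n)) := by
      have e1 : Real.exp (-((2 * d * ξ ^ r - δ / 2) * h n)) =
          Real.exp (-(δ / 2 * h n)) * Real.exp (-((2 * d * ξ ^ r - δ) * h n)) := by
        rw [← Real.exp_add]; congr 1; ring
      rw [e1, Finset.sum_const, Nat.card_Icc, Nat.add_sub_cancel, nsmul_eq_mul]
      ring
    _ ≤ 1 * Real.exp (-((2 * d * ξ ^ r - δ) * h n)) := by
      refine mul_le_mul_of_nonneg_right ?_ (Real.exp_pos _).le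
      refine (mul_le_mul_of_nonneg_left hn4 (by positivity)).trans ?_
      rw [Real.rpow_neg hn0.le, ← div_eq_mul_inv, div_le_one (by positivity)]
      rw [show (2 : ℝ) = ((2 : ℕ) : ℝ) by norm_num, Real.rpow_natCast]
      exact hN1
    _ = _ := one_mul _

end Main

end FPP

/-! ### Assembly of the two bounds. -/

theorem mainTheorem3 {d : ℕ} (hd : 2 ≤ d)
    {Ω : Type*} [MeasurableSpace Ω] (P : Measure Ω) [IsProbabilityMeasure P]
    (τ : FPP.Edge d → Ω → ℝ≥0)
    (hmeas : ∀ e, Measurable (τ e))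
    (hindep : iIndepFun τ P)
    (hident : ∀ e e', IdentDistrib (τ e) (τ e') P P)
    (hzero : ∀ e, P.real {ω | τ e ω = 0} < FPP.criticalProb d)
    (r : ℝ) (hr0 : 0 < r) (hr1 : r < 1)
    (c₁ c₂ b₁ b₂ : ℝ → ℝ)
    (hc₁ : FPP.SlowlyVarying c₁) (hc₂ : FPP.SlowlyVarying c₂)
    (hb₁ : FPP.SlowlyVarying b₁) (hb₂ : FPP.SlowlyVarying b₂)
    (hb : Tendsto (fun t : ℝ => b₁ t / b₂ t) atTop (𝓝 1))
    (hlower : ∀ e, ∀ t : ℝ, 0 < t →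
      c₁ t * Real.exp (-(b₁ t * t ^ r)) ≤ P.real {ω | t < (τ e ω : ℝ)})
    (hupper : ∀ e, ∀ t : ℝ, 0 < t →
      P.real {ω | t < (τ e ω : ℝ)} ≤ c₂ t * Real.exp (-(b₂ t * t ^ r)))
    (x : Fin d → ℝ) (hx : x ≠ 0) :
    Tendsto (fun t : ℝ => t⁻¹ * FPP.meanPassageTime P τ (t • x)) atTop
        (𝓝 (FPP.timeConstant P τ x)) ∧
      ∀ ξ : ℝ, 0 < ξ →
        Tendsto (fun n : ℕ => 1 / (b₁ n * (n : ℝ) ^ r) *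
            Real.log (P.real {ω | (n : ℝ) * (FPP.timeConstant P τ x + ξ) <
              (FPP.passageTime (fun e => τ e ω) 0 ((n : ℝ) • x) : ℝ)}))
          atTop (𝓝 (-2 * d * ξ ^ r)) := by
  set e₀ : FPP.Edge d := FPP.latEdge 0 ⟨0, by omega⟩
  set p : ℝ → ℝ := fun t => P.real {ω | t < (τ e₀ ω : ℝ)} with hp
  set h : ℝ → ℝ := fun t => -Real.log (p t) with hh
  have hanti : Antitone p := fun s t hst => measureReal_mono fun ω hω => hst.trans_lt hω
  have H : FPP.RegularTail h r := FPP.regularTail_neg_log hr0 hr1 hc₁ hc₂ hb₁ hb (hlower e₀)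
    (hupper e₀) hanti fun t => measureReal_le_one
  have hppos : ∀ t, 0 < p t := fun t => by
    have h1 : 0 < max t 1 := lt_max_of_lt_right one_pos
    exact ((mul_pos (hc₁.pos _ h1) (Real.exp_pos _)).trans_le (hlower e₀ _ h1)).trans_le
      (hanti (le_max_left _ _))
  have htail : ∀ e t, P.real {ω | t < (τ e ω : ℝ)} = Real.exp (-h t) := by
    intro e t
    rw [hh, neg_neg, Real.exp_log (hppos t)]
    have hs : MeasurableSet {x : ℝ≥0 | t < (x : ℝ)} :=
      measurableSet_lt measurable_const measurable_coe_nnreal_real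
    have := (hident e e₀).measure_preimage_eq hs
    exact congrArg ENNReal.toReal this
  have hτ : FPP.IIDWeights P τ := ⟨hmeas, hindep, hident,
    fun e => FPP.memLp_two_of_tail H hr0 (hmeas e) (htail e)⟩
  refine ⟨hτ.tendsto_timeConstant x, fun ξ hξ => ?_⟩
  have hnat := tendsto_natCast_atTop_atTop (R := ℝ)
  have hratio : Tendsto (fun n : ℕ => h n / (b₁ n * (n : ℝ) ^ r)) atTop (𝓝 1) :=
    (FPP.tendsto_neg_log_div hr0 hc₁ hc₂ hb₁ hb (hlower e₀) (hupper e₀)).comp hnat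
  set p' : ℕ → ℝ := fun n => P.real {ω | (n : ℝ) * (FPP.timeConstant P τ x + ξ) <
    (FPP.passageTime (fun e => τ e ω) 0 ((n : ℝ) • x) : ℝ)} with hp'
  have hp'eq : ∀ n, p' n = P.real {ω | (n : ℝ) * (FPP.timeConstant P τ x + ξ) <
      (FPP.latticeTime (FPP.config τ ω) 0 (FPP.floorPt ((n : ℝ) • x)) : ℝ)} := fun n => by
    simp only [hp', FPP.passageTime_eq, FPP.floorPt_zero]
    rfl
  have hpos : ∀ᶠ n : ℕ in atTop, 0 < h n :=
    hnat.eventually ((H.tendsto_atTop hr0).eventually_gt_atTop 0)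
  have hmain : Tendsto (fun n : ℕ => Real.log (p' n) / h n) atTop (𝓝 (-2 * d * ξ ^ r)) := by
    rw [Metric.tendsto_nhds]
    intro δ hδ
    filter_upwards [hτ.eventually_exp_le_prob H hr0 htail hx hξ (half_pos hδ),
      hτ.eventually_prob_le_exp H hr0 hr1 htail hd hx hξ (half_pos hδ), hpos] with n h1 h2 h3
    rw [← hp'eq] at h1 h2
    have hp0 : 0 < p' n := (Real.exp_pos _).trans_le h1
    rw [← Real.le_log_iff_exp_le hp0] at h1
    rw [← Real.log_le_iff_le_exp hp0] at h2
    rw [Real.dist_eq, abs_lt]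
    have h4 : -(2 * d * ξ ^ r + δ / 2) ≤ Real.log (p' n) / h n := by
      rw [le_div_iff₀ h3]; linarith
    have h5 : Real.log (p' n) / h n ≤ -(2 * d * ξ ^ r - δ / 2) := by
      rw [div_le_iff₀ h3]; linarith
    constructor <;> linarith
  -- The limit was obtained in the normalisation `h n`; the equivalence `h(n) ~ b₁(n) n^r` converts
  -- it.
  have h6 := hmain.mul hratio
  rw [mul_one] at h6
  refine h6.congr' ?_
  filter_upwards [hpos] with n hn
  rw [div_mul_div_cancel₀ hn.ne', div_eq_mul_one_div, mul_comm]
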